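/- **Theorem (Post-selection multinomial logistic regression).** Let $\{(x_i,d_i)\}_{i=1}^n$ be i.i.d. copies of $(X,D)$ with $D\in\{0,1,\dots,T\}$, $T\ge 1$; let $p_t(x)=\mathbb P[D=t\mid X=x]$ and suppose $p_t(X)\ge p_{\min}>0$ almost surely for $t=0,\dots,T$. Let $x_i^*\in\mathbb R^p$ be a fixed measurable transformation of $x_i$ with $\max_j|x^*_{i,j}|\le\mathcal X$ almost surely. Write $\mathbb E_n[w_i]=\frac1n\sum_{i}w_i$ and $Q=\mathbb E_n[x_i^*x_i^{*\prime}]$. For $m\in\mathbb R^T$ let $\hat p_t(m)=e^{m_t}/(1+\sum_{r=1}^T e^{m_r})$, $1\le t\le T$, and $\hat p_0(m)=1-\sum_{t\ge1}\hat p_t(m)$. For $\gamma=(\gamma_{t,j})\in\mathbb R^{T\times p}$ let $$\mathcal M(\gamma)=\sum_{t=0}^T\mathbb E_n\big[-\mathbf 1\{d_i=t\}\log\hat p_t(\{x_i^{*\prime}\gamma_r\}_{r=1}^T)\big],\qquad |||\gamma|||=\sum_{j=1}^p\|\gamma_{\cdot,j}\|_2 ,$$ and $\operatorname{supp}\gamma=\{j:\gamma_{\cdot,j}\ne0\}$.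 Fix $\gamma^*\in\mathbb R^{T\times p}$ with $S_*=\operatorname{supp}\gamma^*$ and $s=|S_*|<n$. Fix $\delta>0$ and put $$\lambda=\frac{2\mathcal X\sqrt T}{\sqrt n}\Big(1+\frac{\log(p\vee n)^{3/2+\delta}}{\sqrt T}\Big)^{1/2},\qquad \mathcal P=\frac{4\sqrt{\log(2p)(1+64\log(12p)^2)}}{\log(p\vee n)^{3/2+\delta}} .$$ Let $\tilde\gamma$ minimize $\mathcal M(\gamma)+\lambda|||\gamma|||$ over $\gamma$, let $\hat S\supseteq\operatorname{supp}\tilde\gamma$ be any (possibly data-dependent) set with $|\hat S|\le s$, and let $\hat\gamma$ minimize $\mathcal M(\gamma)$ over $\operatorname{supp}\gamma\subseteq\hat S$. Let $S_D=\hat S\cup S_*$ and $\underline\phi=\big(\min\{\delta'Q\delta/\|\delta\|_2^2:\ 0\ne\delta\in\mathbb R^p,\ \delta_j=0\text{ for }j\notin S_D\}\big)^{1/2}$. The quantities $b,\kappa,A_K$ below may depend on the sample. Consider the following conditions on the sample: 1. (bias) $\mathbb E_n[(\hat p_t(\{x_i^{*\prime}\gamma^*_r\}_r)-p_t(x_i))^2]^{1/2}\le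 b$ for $1\le t\le T$, and $b<p_{\min}$; 2. (eigenvalues) $\underline\phi>0$, $\kappa>0$ and $\kappa^2\le\sum_{t=1}^T\delta_t'Q\delta_t\big/\|\delta_{\cdot,S_*}\|_2^2$ for every $\delta\in\mathbb R^{T\times p}\setminus\{0\}$ with $|||\delta_{\cdot,S_*^c}|||\le4|||\delta_{\cdot,S_*}|||$; 3. (choice of $A_K$) with $A_p=p_{\min}/(p_{\min}-b)$ and $$R_{\mathcal M}=\Big(\frac{A_p}{p_{\min}}\Big)^{T+1}TA_K\Big(6\frac{\lambda\sqrt s}{\kappa}+8b\sqrt T\Big),$$ the three denominators below are positive and $$A_K>\frac{2\kappa^2}{\kappa^2-\frac23\mathcal X\sqrt T\big(30\lambda s+100\sqrt s\,\kappa b\sqrt T+80\kappa^2b^2T\lambda^{-1}\big)},$$ $$A_K>\frac{2\underline\phi^2}{\underline\phi^2-\mathcal X\sqrt T\big(\lambda|S_D|+b\underline\phi\sqrt T\sqrt{|S_D|}\big)}\ \vee\ \frac{\underline\phi}{\underline\phi-2R_{\mathcal M}\mathcal X\sqrt T\sqrt{|S_D|}} .$$ Define $R_{\mathcal M}'=(A_p/p_{\min})^{T+1}TA_K\big(\lambda\sqrt{|S_D|}\,\underline\phi^{-1}/2+b\sqrt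 T\big)$ and $$R_{\mathcal M}''=R_{\mathcal M}\vee\Big\{R_{\mathcal M}'+\Big[R_{\mathcal M}'R_{\mathcal M}+\Big(\frac{A_p}{p_{\min}}\Big)^{T+1}TA_KR_{\mathcal M}^2\Big]^{1/2}\Big\}.$$ Then, except on an event of probability at most $\mathcal P$, whenever conditions 1–3 hold and the minimizers $\tilde\gamma,\hat\gamma$ exist, $$\max_{1\le t\le T}\mathbb E_n\big[(\hat p_t(\{x_i^{*\prime}\hat\gamma_r\}_r)-p_t(x_i))^2\big]^{1/2}\le R_{\mathcal M}''+b \quad\text{and}\quad \max_{1\le t\le T}\|\hat\gamma_t-\gamma_t^*\|_1\le\frac{\sqrt{|S_D|}}{\underline\phi}\,R_{\mathcal M}'' .$$ -/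

import Mathlib

open MeasureTheory ProbabilityTheory

noncomputable section

namespace PostMLogit

/-! Treatments are `Fin (T + 1)`: `0` is the baseline and `t.succ`, for `t : Fin T`, runs over the
nonbaseline treatments `1, …, T`. -/

/-- Coefficients `γ t j`, one vector of length `p` for each nonbaseline treatment `t`. -/
abbrev Coef (T p : ℕ) : Type := Fin T → Fin p → ℝ

/-- The empirical expectation `𝔼ₙ[w i] = (∑ i, w i) / n`. -/
def empMean {n : ℕ} (w : Fin n → ℝ) : ℝ := (∑ i, w i) / n

/-- The multinomial logit function: `exp (m t) / (1 + ∑ s, exp (m s))` for a nonbaseline treatment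
`t`, and `1 / (1 + ∑ s, exp (m s))` for the baseline. -/
def mlogit {T : ℕ} (m : Fin T → ℝ) (t : Fin (T + 1)) : ℝ :=
  (Fin.cons 1 (fun s => Real.exp (m s)) : Fin (T + 1) → ℝ) t / (1 + ∑ s, Real.exp (m s))

/-- The linear indices `(xᵢ' γ t)` over `t`, for observation `i`. -/
def index {n p T : ℕ} (x : Fin n → Fin p → ℝ) (γ : Coef T p) (i : Fin n) (t : Fin T) : ℝ :=
  ∑ j, x i j * γ t j

/-- The multinomial logistic loss `ℳ(γ)`: the average negative log-likelihood. -/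
def loss {n p T : ℕ} (x : Fin n → Fin p → ℝ) (d : Fin n → Fin (T + 1)) (γ : Coef T p) : ℝ :=
  ∑ t : Fin (T + 1),
    empMean fun i => -(if d i = t then (1 : ℝ) else 0) * Real.log (mlogit (index x γ i) t)

/-- The part over `j ∈ S` of the mixed `ℓ₂/ℓ₁` norm: `∑ j ∈ S, ‖δ_{·,j}‖₂`. -/
def groupNormOn {p T : ℕ} (S : Finset (Fin p)) (δ : Coef T p) : ℝ :=
  ∑ j ∈ S, √(∑ t, δ t j ^ 2)

/-- The mixed `ℓ₂/ℓ₁` norm: `∑ j, ‖δ_{·,j}‖₂`. -/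
def groupNorm {p T : ℕ} (δ : Coef T p) : ℝ := groupNormOn Finset.univ δ

open Classical in
/-- The set of covariates `j` whose coefficient is nonzero for some treatment. -/
def groupSupport {p T : ℕ} (γ : Coef T p) : Finset (Fin p) :=
  Finset.univ.filter fun j => ∃ t, γ t j ≠ 0

/-- `γ` is a group lasso estimate with penalty parameter `lam`. -/
def IsGroupLasso {n p T : ℕ} (x : Fin n → Fin p → ℝ) (d : Fin n → Fin (T + 1)) (lam : ℝ)
    (γ : Coef T p) : Prop :=
  ∀ γ' : Coef T p, loss x d γ + lam * groupNorm γ ≤ loss x d γ' + lam * groupNorm γ'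

/-- `γ` is an unpenalized multinomial logit estimate that uses only the covariates in `S`. -/
def IsRefit {n p T : ℕ} (x : Fin n → Fin p → ℝ) (d : Fin n → Fin (T + 1)) (S : Finset (Fin p))
    (γ : Coef T p) : Prop :=
  groupSupport γ ⊆ S ∧ ∀ γ' : Coef T p, groupSupport γ' ⊆ S → loss x d γ ≤ loss x d γ'

/-- The empirical Gram matrix `Q = 𝔼ₙ[xᵢ xᵢ']`. -/
def gram {n p : ℕ} (x : Fin n → Fin p → ℝ) : Matrix (Fin p) (Fin p) ℝ :=
  Matrix.of fun j k => empMean fun i => x i j * x i k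

/-- The quadratic form `δ' Q δ`. -/
def quadForm {p : ℕ} (Q : Matrix (Fin p) (Fin p) ℝ) (δ : Fin p → ℝ) : ℝ := δ ⬝ᵥ Q.mulVec δ

/-- The minimal sparse eigenvalue `φ{Q, S}`, on the square root scale: its square is the minimum of
`δ' Q δ / ‖δ‖₂²` over the nonzero vectors supported in `S`. -/
def sparseEigMin {p : ℕ} (Q : Matrix (Fin p) (Fin p) ℝ) (S : Finset (Fin p)) : ℝ :=
  √(sInf {r : ℝ | ∃ δ : Fin p → ℝ, δ ≠ 0 ∧ (∀ j, j ∉ S → δ j = 0) ∧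
    r = quadForm Q δ / ∑ j, δ j ^ 2})

/-- `κ²` is a lower bound for the minimal restricted eigenvalue of `Q` over the cone
`⦀δ_{·,Sᶜ}⦀ ≤ 4 ⦀δ_{·,S}⦀`. -/
def IsRestrictedEigBound {p : ℕ} (T : ℕ) (Q : Matrix (Fin p) (Fin p) ℝ) (S : Finset (Fin p))
    (κ : ℝ) : Prop :=
  ∀ δ : Coef T p, δ ≠ 0 → groupNormOn Sᶜ δ ≤ 4 * groupNormOn S δ →
    κ ^ 2 ≤ (∑ t, quadForm Q (δ t)) / ∑ t, ∑ j ∈ S, δ t j ^ 2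

/-- The prediction error `𝔼ₙ[(p̂_t(xᵢ'γ) - p_t(xᵢ))²]^{1/2}`, where `pr i t = p_t(xᵢ)`. -/
def propError {n p T : ℕ} (x : Fin n → Fin p → ℝ) (pr : Fin n → Fin (T + 1) → ℝ) (γ : Coef T p)
    (t : Fin (T + 1)) : ℝ :=
  √(empMean fun i => (mlogit (index x γ i) t - pr i t) ^ 2)

/-- The penalty parameter `λ_D`. -/
def penalty (n p T : ℕ) (X δD : ℝ) : ℝ :=
  2 * X * √T / √n * √(1 + Real.log (max p n : ℕ) ^ (3 / 2 + δD) / √T)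

/-- The probability `𝒫`. -/
def excProb (n p : ℕ) (δD : ℝ) : ℝ :=
  4 * √(Real.log (2 * p) * (1 + 64 * Real.log (12 * p) ^ 2)) /
    Real.log (max p n : ℕ) ^ (3 / 2 + δD)

/-- `A_p = p_min / (0 ∨ (p_min - b))`. -/
def Ap (pmin b : ℝ) : ℝ := pmin / max 0 (pmin - b)

/-- The group lasso rate `R_ℳ`; `s` is the number of relevant covariates. -/
def RM (T s : ℕ) (lam pmin b κ A : ℝ) : ℝ :=
  (Ap pmin b / pmin) ^ (T + 1) * T * A * (6 * (lam * √s / κ) + 8 * b * √T)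

/-- The denominator in the lower bound on `A_K` for the group lasso. -/
def lassoDen (T s : ℕ) (X lam b κ : ℝ) : ℝ :=
  κ ^ 2 - 2 / 3 * X * √T *
    (30 * lam * s + 100 * √s * κ * b * √T + 80 * κ ^ 2 * b ^ 2 * T * lam⁻¹)

/-- The denominator in the first lower bound on `A_K` for the refit, with `k = |S_D|`. -/
def refitDen₁ (T k : ℕ) (X lam b φ : ℝ) : ℝ :=
  φ ^ 2 - X * √T * (lam * k + b * φ * √T * √k)

/-- The denominator in the second lower bound on `A_K` for the refit; `R` is `R_ℳ`. -/
def refitDen₂ (T k : ℕ) (X φ R : ℝ) : ℝ := φ - 2 * R * X * √T * √k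

/-- The rate `R_ℳ'`. -/
def RM' (T k : ℕ) (lam pmin b φ A : ℝ) : ℝ :=
  (Ap pmin b / pmin) ^ (T + 1) * T * A * (lam * √k * φ⁻¹ / 2 + b * √T)

/-- The rate `R_ℳ''`, from `R = R_ℳ` and `R' = R_ℳ'`. -/
def RM'' (T : ℕ) (pmin b A R R' : ℝ) : ℝ :=
  max R (R' + √(R' * R + (Ap pmin b / pmin) ^ (T + 1) * T * A * R ^ 2))

/-- The conditions on the constants. Positivity says that the eigenvalue bounds, `A_p` and the
lower bounds on `A_K` are finite. -/
structure RateConditions (T s k : ℕ) (X lam pmin b κ φ A : ℝ) : Prop where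
  b_lt : b < pmin
  kappa_pos : 0 < κ
  phi_pos : 0 < φ
  lassoDen_pos : 0 < lassoDen T s X lam b κ
  refitDen₁_pos : 0 < refitDen₁ T k X lam b φ
  refitDen₂_pos : 0 < refitDen₂ T k X φ (RM T s lam pmin b κ A)
  lasso_lt : 2 * κ ^ 2 * (lassoDen T s X lam b κ)⁻¹ < A
  refit_lt : max (2 * (φ ^ 2 / refitDen₁ T k X lam b φ))
    (φ / refitDen₂ T k X φ (RM T s lam pmin b κ A)) < A

/-- `pr t` is a (measurable) version of the conditional probability `P[D = t | X = ·]`, where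
`(X, D)` has law `P`. -/
def IsPropensityScore {E : Type*} [MeasurableSpace E] {T : ℕ} (P : Measure (E × Fin (T + 1)))
    (pr : Fin (T + 1) → E → ℝ) : Prop :=
  ∀ t, Measurable (pr t) ∧
    P[Set.indicator {z : E × Fin (T + 1) | z.2 = t} (fun _ => (1 : ℝ)) |
      MeasurableSpace.comap Prod.fst inferInstance] =ᵐ[P] fun z => pr t z.1

/-- The conclusion for one realization of the sample: whenever the bias bound, the eigenvalue bound
and the conditions on the constants hold for it, every refit on a set `Ŝ` of at most `s` covariates
that contains those selected by the group lasso satisfies both error bounds. -/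
def RefitBounds {n p T : ℕ} (x : Fin n → Fin p → ℝ) (d : Fin n → Fin (T + 1))
    (pr : Fin n → Fin (T + 1) → ℝ) (γs : Coef T p) (X lam pmin b κ A : ℝ)
    (Shat : Finset (Fin p)) (γt γh : Coef T p) : Prop :=
  let Ss := groupSupport γs
  let s := Ss.card
  let SD := Shat ∪ Ss
  let φ := sparseEigMin (gram x) SD
  let R := RM T s lam pmin b κ A
  let R'' := RM'' T pmin b A R (RM' T SD.card lam pmin b φ A)
  (∀ t : Fin T, propError x pr γs t.succ ≤ b) →
  IsRestrictedEigBound T (gram x) Ss κ →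
  RateConditions T s SD.card X lam pmin b κ φ A →
  IsGroupLasso x d lam γt →
  groupSupport γt ⊆ Shat → Shat.card ≤ s →
  IsRefit x d Shat γh →
  (∀ t : Fin T, propError x pr γh t.succ ≤ R'' + b) ∧
  (∀ t : Fin T, ∑ j, |γh t j - γs t j| ≤ √SD.card / φ * R'')

end PostMLogit

end

namespace PostMLogit

/-! Write `δ = γ - γs`, and measure size by the prediction norm `√(predSq x δ)`. The loss is a
log-partition function minus a linear term, so its increment at `γs` splits into a Bregman
divergence, free of the treatments, and a linear term made of bias and noise (`loss_add`).

Both the lasso error and the refit error vanish outside `S_D = Ŝ ∪ S_*`, which has at most `2s`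
elements. It therefore suffices to control the noise uniformly over directions using at most `2s`
covariates, relative to their prediction norm (`NoiseBound`), at level `ν = 3λ√s/(4X)`. This single
event does not involve `Ŝ`, the estimates or the constants, so all of these may depend on the
sample.

On that event the argument is deterministic. Overlap and small bias make the divergence at least a
multiple of `predSq x δ` while the indices stay small (`le_lossBregman`), and convexity along rays
turns this local bound into a global one (`sqrt_predSq_le_of_lossBregman`). The restricted
eigenvalue bound and lasso optimality bound the lasso error. The refit has no larger loss than the
lasso, so its divergence is bounded by the lasso's plus linear terms, and its prediction norm stays
below `R_ℳ ≤ R_ℳ''` (`sqrt_predSq_refit_le`). A Lipschitz bound for the logit and the sparse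
eigenvalue give the two conclusions.

For the probability, treatments are independent given the covariates (`IsPropensityScore.pi_apply`).
For a fixed choice of `2s` columns, the worst ratio of noise to prediction norm is governed by the
length of the projection of the noise on the column span. That vector is sub-Gaussian, and mixing
over Gaussian directions bounds its exponential square moment (`sum_mul_exp_sq_le`). Markov's
inequality and a union bound over `p ^ (2s)` choices of columns finish the proof, since the penalty
dominates both the dimension `2Ts` and the entropy `2s log p`. -/

/-- A vector of nonbaseline indices, extended by the index `0` of the baseline. -/
def withBaseline {T : ℕ} (v : Fin T → ℝ) : Fin (T + 1) → ℝ := Fin.cons 0 v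

/-- The log-partition function `log (1 + ∑ s, exp (m s))`. -/
noncomputable def logPartition {T : ℕ} (m : Fin T → ℝ) : ℝ := Real.log (1 + ∑ s, Real.exp (m s))

/-- The Bregman divergence of the log-partition function. -/
noncomputable def bregman {T : ℕ} (m v : Fin T → ℝ) : ℝ :=
  logPartition (m + v) - logPartition m - ∑ t : Fin T, mlogit m t.succ * v t

/-! ### Convexity and smoothness of the multinomial logit at a single observation. -/

section Logit

variable {T : ℕ}

lemma partition_pos (m : Fin T → ℝ) : 0 < 1 + ∑ s, Real.exp (m s) := by positivity

lemma mlogit_eq (m : Fin T → ℝ) (t : Fin (T + 1)) :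
    mlogit m t = Real.exp (withBaseline m t) / (1 + ∑ s, Real.exp (m s)) := by
  unfold mlogit withBaseline
  refine Fin.cases ?_ (fun s => ?_) t <;> simp

lemma mlogit_pos (m : Fin T → ℝ) (t : Fin (T + 1)) : 0 < mlogit m t := by
  rw [mlogit_eq]; exact div_pos (Real.exp_pos _) (partition_pos m)

lemma sum_mlogit (m : Fin T → ℝ) : ∑ t, mlogit m t = 1 := by
  simp_rw [mlogit_eq, ← Finset.sum_div]
  rw [Fin.sum_univ_succ, div_eq_one_iff_eq (partition_pos m).ne']
  simp [withBaseline]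

lemma log_mlogit (m : Fin T → ℝ) (t : Fin (T + 1)) :
    Real.log (mlogit m t) = withBaseline m t - logPartition m := by
  rw [mlogit_eq, Real.log_div (Real.exp_pos _).ne' (partition_pos m).ne', Real.log_exp]
  rfl

lemma sum_mul_withBaseline (q : Fin (T + 1) → ℝ) (v : Fin T → ℝ) :
    ∑ t, q t * withBaseline v t = ∑ t : Fin T, q t.succ * v t := by
  simp [Fin.sum_univ_succ, withBaseline]

lemma sum_withBaseline_sq (v : Fin T → ℝ) : ∑ t, withBaseline v t ^ 2 = ∑ t, v t ^ 2 := by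
  simp [Fin.sum_univ_succ, withBaseline]

lemma withBaseline_sq_le (v : Fin T → ℝ) (t : Fin (T + 1)) :
    withBaseline v t ^ 2 ≤ ∑ t, v t ^ 2 := by
  rw [← sum_withBaseline_sq]
  exact Finset.single_le_sum (f := fun t => withBaseline v t ^ 2) (fun s _ => sq_nonneg _)
    (Finset.mem_univ t)

/-- Two distinct entries together use at most the whole squared length, which gives the factor `2`.
This oscillation bound serves both the Lipschitz estimate and Hoeffding's lemma. -/
lemma withBaseline_sub_sq_le (v : Fin T → ℝ) (s t : Fin (T + 1)) :
    (withBaseline v s - withBaseline v t) ^ 2 ≤ 2 * ∑ t, v t ^ 2 := by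
  by_cases h : s = t
  · subst h; simp; positivity
  · have h2 : withBaseline v s ^ 2 + withBaseline v t ^ 2 ≤ ∑ t, v t ^ 2 := by
      rw [← sum_withBaseline_sq, ← Finset.sum_pair h (f := fun t => withBaseline v t ^ 2)]
      exact Finset.sum_le_sum_of_subset_of_nonneg (Finset.subset_univ _)
        (fun _ _ _ => sq_nonneg _)
    nlinarith [sq_nonneg (withBaseline v s + withBaseline v t)]

/-- Shifting the indices is an exponential tilt of the logit distribution, so increments of the
log-partition function are cumulant generating functions. -/
lemma partition_add (m v : Fin T → ℝ) :
    1 + ∑ s, Real.exp ((m + v) s) =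
      (1 + ∑ s, Real.exp (m s)) * ∑ t, mlogit m t * Real.exp (withBaseline v t) := by
  have h := partition_pos m
  simp_rw [mlogit_eq, div_mul_eq_mul_div, ← Finset.sum_div]
  rw [mul_div_cancel₀ _ h.ne', Fin.sum_univ_succ]
  simp [withBaseline, Real.exp_add]

lemma tilt_pos (m v : Fin T → ℝ) : 0 < ∑ t, mlogit m t * Real.exp (withBaseline v t) :=
  Finset.sum_pos (fun t _ => mul_pos (mlogit_pos m t) (Real.exp_pos _)) Finset.univ_nonempty

lemma mlogit_add (m v : Fin T → ℝ) (t : Fin (T + 1)) :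
    mlogit (m + v) t = mlogit m t * Real.exp (withBaseline v t) /
      ∑ s, mlogit m s * Real.exp (withBaseline v s) := by
  have h := partition_pos m
  have h2 := tilt_pos m v
  have h3 : withBaseline (m + v) t = withBaseline m t + withBaseline v t := by
    unfold withBaseline
    refine Fin.cases ?_ (fun s => ?_) t <;> simp
  rw [mlogit_eq (m + v), partition_add, h3, Real.exp_add, mlogit_eq m t]
  field_simp

lemma bregman_eq_log (m v : Fin T → ℝ) :
    bregman m v = Real.log (∑ t, mlogit m t * Real.exp (withBaseline v t)) -
      ∑ t : Fin T, mlogit m t.succ * v t := by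
  unfold bregman logPartition
  rw [partition_add, Real.log_mul (partition_pos m).ne' (tilt_pos m v).ne']
  ring

/-- Convexity along a ray on which the divergence starts from `0`. It is the power mean inequality
with exponent `1/τ` applied to `exp (τ V)`, after taking logarithms. -/
lemma bregman_smul_le (m v : Fin T → ℝ) {τ : ℝ} (h0 : 0 < τ) (h1 : τ ≤ 1) :
    bregman m (τ • v) ≤ τ * bregman m v := by
  have hb : ∀ t, withBaseline (τ • v) t = τ * withBaseline v t := by
    intro t; unfold withBaseline
    refine Fin.cases ?_ (fun s => ?_) t <;> simp
  have hj := Real.rpow_arith_mean_le_arith_mean_rpow Finset.univ (mlogit m)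
    (fun t => Real.exp (τ * withBaseline v t)) (fun t _ => (mlogit_pos m t).le) (sum_mlogit m)
    (fun t _ => (Real.exp_pos _).le) (one_le_one_div h0 h1)
  have he : ∀ t, Real.exp (τ * withBaseline v t) ^ (1 / τ) = Real.exp (withBaseline v t) := by
    intro t
    rw [← Real.exp_mul]; congr 1; field_simp
  simp_rw [he] at hj
  have hp := tilt_pos m (τ • v)
  simp_rw [hb] at hp
  have hl := Real.log_le_log (Real.rpow_pos_of_pos hp _) hj
  rw [Real.log_rpow hp] at hl
  rw [bregman_eq_log, bregman_eq_log]
  simp_rw [hb]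
  have : Real.log (∑ t, mlogit m t * Real.exp (τ * withBaseline v t)) ≤
      τ * Real.log (∑ t, mlogit m t * Real.exp (withBaseline v t)) := by
    calc _ = τ * (1 / τ * Real.log (∑ t, mlogit m t * Real.exp (τ * withBaseline v t))) := by
          field_simp
      _ ≤ _ := mul_le_mul_of_nonneg_left hl h0.le
  have h2 : ∑ t : Fin T, mlogit m t.succ * (τ • v) t =
      τ * ∑ t : Fin T, mlogit m t.succ * v t := by
    rw [Finset.mul_sum]; exact Finset.sum_congr rfl fun t _ => by simp; ring
  rw [h2]; linarith

/-- The variance of the treatment-indexed vector `v` (with baseline entry `0`) under weights `q`. -/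
noncomputable def indexVar (q : Fin (T + 1) → ℝ) (v : Fin T → ℝ) : ℝ :=
  ∑ t : Fin T, q t.succ * v t ^ 2 - (∑ t : Fin T, q t.succ * v t) ^ 2

lemma exp_ge_quadratic {w : ℝ} (h : |w| ≤ 1 / 2) : 1 + w + 3 / 8 * w ^ 2 ≤ Real.exp w := by
  -- The Taylor remainder is at most `2/9 * |w|^3 ≤ w^2/9`, and `1/2 - 1/9 > 3/8`.
  have h1 := Real.exp_bound (x := w) (by linarith) (n := 3) (by norm_num)
  rw [abs_le] at h1
  have h2 := h1.1
  simp [Finset.sum_range_succ, Nat.factorial] at h2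
  have h3 : |w| ^ 3 ≤ 1 / 2 * w ^ 2 := by
    calc |w| ^ 3 = |w| * |w| ^ 2 := by ring
      _ = |w| * w ^ 2 := by rw [sq_abs]
      _ ≤ _ := mul_le_mul_of_nonneg_right h (sq_nonneg _)
  nlinarith [sq_nonneg w]

/-- The divergence is the log of the mean of `exp (V - a)`, with `a` the mean of `V`. As `|V - a| ≤
1/2`, the quadratic bound for `exp` averages to `1 + 3/8 * indexVar`, the linear term vanishing; the
logarithm then costs only a factor `24/25`. -/
lemma le_bregman (m v : Fin T → ℝ) (hv : ∑ t, v t ^ 2 ≤ 1 / 16) :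
    9 / 25 * indexVar (mlogit m) v ≤ bregman m v := by
  set q := mlogit m with hq
  set V := withBaseline v with hV
  set a := ∑ t : Fin T, q t.succ * v t with ha
  have haV : ∑ t, q t * V t = a := sum_mul_withBaseline q v
  have hq0 : ∀ t, 0 ≤ q t := fun t => (mlogit_pos m t).le
  have hq1 : ∑ t, q t = 1 := sum_mlogit m
  have hVb : ∀ t, |V t| ≤ 1 / 4 := fun t => by
    have := (withBaseline_sq_le v t).trans hv
    exact abs_le_of_sq_le_sq (by norm_num; linarith) (by norm_num)
  have hab : |a| ≤ 1 / 4 := by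
    rw [← haV]
    calc |∑ t, q t * V t| ≤ ∑ t, |q t * V t| := Finset.abs_sum_le_sum_abs _ _
      _ ≤ ∑ t, q t * (1 / 4) := Finset.sum_le_sum fun t _ => by
          rw [abs_mul, abs_of_nonneg (hq0 t)]
          exact mul_le_mul_of_nonneg_left (hVb t) (hq0 t)
      _ = 1 / 4 := by rw [← Finset.sum_mul, hq1, one_mul]
  have hsq : ∑ t, q t * V t ^ 2 = ∑ t : Fin T, q t.succ * v t ^ 2 := by
    simp [Fin.sum_univ_succ, hV, withBaseline]
  have hvar : ∑ t, q t * (V t - a) ^ 2 = indexVar q v := by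
    have : ∀ t, q t * (V t - a) ^ 2 = q t * V t ^ 2 - 2 * a * (q t * V t) + a ^ 2 * q t :=
      fun t => by ring
    simp_rw [this, Finset.sum_add_distrib, Finset.sum_sub_distrib, ← Finset.mul_sum]
    rw [haV, hq1, hsq, indexVar]; ring
  have hvar0 : 0 ≤ indexVar q v := by
    rw [← hvar]; exact Finset.sum_nonneg fun t _ => mul_nonneg (hq0 t) (sq_nonneg _)
  have hvar1 : indexVar q v ≤ 1 / 16 := by
    have h1 : ∑ t, q t * V t ^ 2 ≤ ∑ t, q t * (1 / 16) := Finset.sum_le_sum fun t _ =>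
      mul_le_mul_of_nonneg_left ((withBaseline_sq_le v t).trans hv) (hq0 t)
    rw [← Finset.sum_mul, hq1, hsq] at h1
    unfold indexVar
    nlinarith [sq_nonneg (∑ t : Fin T, q t.succ * v t)]
  have hmain : 1 + 3 / 8 * indexVar q v ≤ Real.exp (bregman m v) := by
    rw [bregman_eq_log, Real.exp_sub, Real.exp_log (tilt_pos m v)]
    have : ∀ t, q t * (1 + (V t - a) + 3 / 8 * (V t - a) ^ 2) ≤
        q t * Real.exp (V t) / Real.exp a := fun t => by
      rw [mul_div_assoc, ← Real.exp_sub]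
      refine mul_le_mul_of_nonneg_left (exp_ge_quadratic ?_) (hq0 t)
      calc |V t - a| ≤ |V t| + |a| := abs_sub _ _
        _ ≤ 1 / 2 := by linarith [hVb t]
    have h2 := Finset.sum_le_sum fun t (_ : t ∈ Finset.univ) => this t
    rw [← Finset.sum_div] at h2
    refine le_trans (le_of_eq ?_) h2
    have : ∀ t, q t * (1 + (V t - a) + 3 / 8 * (V t - a) ^ 2) =
        (1 - a) * q t + q t * V t + 3 / 8 * (q t * (V t - a) ^ 2) := fun t => by ring
    simp_rw [this, Finset.sum_add_distrib, ← Finset.mul_sum]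
    rw [hvar, hq1, haV]; ring
  set y := 3 / 8 * indexVar q v with hy
  have hy0 : 0 ≤ y := by positivity
  have hlog : 1 - (1 + y)⁻¹ ≤ bregman m v := by
    have h1 := Real.one_sub_inv_le_log_of_pos (x := 1 + y) (by linarith)
    have h2 := Real.log_le_log (by linarith) hmain
    rw [Real.log_exp] at h2
    linarith
  refine le_trans ?_ hlog
  -- Valid for `0 ≤ y ≤ 1/24`; here `y ≤ 3/128`.
  have h3 : (1 + y)⁻¹ ≤ 1 - 24 / 25 * y := by
    rw [inv_le_iff_one_le_mul₀ (by linarith)]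
    nlinarith
  linarith

lemma mlogit_add_sub_le (m v : Fin T → ℝ) (hv : ∑ t, v t ^ 2 ≤ 1 / 16) (t : Fin (T + 1)) :
    mlogit (m + v) t - mlogit m t ≤ √(∑ t, v t ^ 2) := by
  set η := √(∑ t, v t ^ 2) with hη
  have hη0 : 0 ≤ η := Real.sqrt_nonneg _
  have hη2 : η ^ 2 = ∑ t, v t ^ 2 := Real.sq_sqrt (by positivity)
  have hη4 : η ≤ 1 / 4 := by nlinarith
  set V := withBaseline v with hV
  -- A rational bound for the oscillation `√2 * η` of `V`.
  set ρ := 3 / 2 * η with hρ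
  have hd : ∀ s t, V s - V t ≤ ρ := fun s t => by
    have := withBaseline_sub_sq_le v s t
    rw [← hη2] at this
    exact le_of_abs_le (abs_le_of_sq_le_sq (by nlinarith) (by positivity))
  set Z := ∑ s, mlogit m s * Real.exp (V s) with hZ
  have hZ0 : 0 < Z := tilt_pos m v
  have hup : ∀ s, (1 - ρ) * Real.exp (V s) ≤ Z := fun s => by
    have h1 : ∀ r, mlogit m r * ((1 - ρ) * Real.exp (V s)) ≤ mlogit m r * Real.exp (V r) :=
      fun r => by
        refine mul_le_mul_of_nonneg_left ?_ (mlogit_pos m r).le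
        have := Real.add_one_le_exp (V r - V s)
        rw [Real.exp_sub, le_div_iff₀ (Real.exp_pos _)] at this
        nlinarith [hd s r, Real.exp_pos (V s)]
    have h2 := Finset.sum_le_sum fun r (_ : r ∈ Finset.univ) => h1 r
    rwa [← Finset.sum_mul, sum_mlogit, one_mul] at h2
  have hlo : ∀ s, (1 - ρ) * Z ≤ Real.exp (V s) := fun s => by
    have h1 : ∀ r, (1 - ρ) * (mlogit m r * Real.exp (V r)) ≤ mlogit m r * Real.exp (V s) :=
      fun r => by
        rw [mul_left_comm]
        refine mul_le_mul_of_nonneg_left ?_ (mlogit_pos m r).le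
        have := Real.add_one_le_exp (V s - V r)
        rw [Real.exp_sub, le_div_iff₀ (Real.exp_pos _)] at this
        nlinarith [hd r s, Real.exp_pos (V r)]
    have h2 := Finset.sum_le_sum fun r (_ : r ∈ Finset.univ) => h1 r
    rwa [← Finset.mul_sum, ← Finset.sum_mul, sum_mlogit, one_mul] at h2
  have hp : ∀ s, mlogit (m + v) s = mlogit m s * (Real.exp (V s) / Z) := fun s => by
    rw [mlogit_add, mul_div_assoc]
  have ha : (1 - ρ) * mlogit (m + v) t ≤ mlogit m t := by
    rw [hp, mul_left_comm]
    refine mul_le_of_le_one_right (mlogit_pos m t).le ?_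
    rw [← mul_div_assoc, div_le_one hZ0]
    exact hup t
  have hb : (1 - ρ) * (1 - mlogit m t) ≤ 1 - mlogit (m + v) t := by
    have h1 : ∀ q : Fin (T + 1) → ℝ, ∑ s, q s = 1 → 1 - q t = ∑ s ∈ Finset.univ.erase t, q s :=
      fun q hq => by rw [← hq, ← Finset.add_sum_erase _ _ (Finset.mem_univ t)]; ring
    rw [h1 _ (sum_mlogit m), h1 _ (sum_mlogit (m + v)), Finset.mul_sum]
    refine Finset.sum_le_sum fun s _ => ?_
    rw [hp, mul_comm]
    refine mul_le_mul_of_nonneg_left ?_ (mlogit_pos m s).le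
    rw [le_div_iff₀ hZ0]
    exact hlo s
  -- With `Δ` the increment, `ha` reads `Δ ≤ ρ (p + Δ)` and `hb` reads `Δ ≤ ρ (1 - p)`. Adding them
  -- gives `Δ ≤ ρ / (2 - ρ)`, which is at most `η` because `ρ ≤ 3/8`.
  nlinarith

lemma abs_mlogit_add_sub_le (m v : Fin T → ℝ) (hv : ∑ t, v t ^ 2 ≤ 1 / 16) (t : Fin (T + 1)) :
    |mlogit (m + v) t - mlogit m t| ≤ √(∑ t, v t ^ 2) := by
  have h := mlogit_add_sub_le (m + v) (-v) (by simpa using hv) t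
  simp only [add_neg_cancel_right, Pi.neg_apply, neg_sq] at h
  exact abs_sub_le_iff.2 ⟨mlogit_add_sub_le m v hv t, h⟩

/-- Perturbation of the variance lower bound `pmin ^ 2 * ‖v‖²`, valid under overlap, when the true
probabilities `q` are replaced by approximations `q'`. -/
lemma le_indexVar (q q' : Fin (T + 1) → ℝ) (v : Fin T → ℝ) {pmin : ℝ} (h0 : 0 ≤ pmin)
    (hq : ∀ t, pmin ≤ q t) (hq1 : ∑ t, q t = 1) (hq' : ∀ t, 0 ≤ q' t) (hq1' : ∑ t, q' t = 1) :
    pmin ^ 2 * ∑ t, v t ^ 2 -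
      3 * √(∑ t : Fin T, (q' t.succ - q t.succ) ^ 2) * ∑ t, v t ^ 2 ≤ indexVar q' v := by
  have hq0 : ∀ t, 0 ≤ q t := fun t => h0.trans (hq t)
  have hs : ∑ t : Fin T, q t.succ = 1 - q 0 := by
    rw [Fin.sum_univ_succ] at hq1; linarith
  have hs' : ∑ t : Fin T, q' t.succ = 1 - q' 0 := by
    rw [Fin.sum_univ_succ] at hq1'; linarith
  set η := √(∑ t, v t ^ 2) with hη
  have hη0 : 0 ≤ η := Real.sqrt_nonneg _
  have hη2 : η ^ 2 = ∑ t, v t ^ 2 := Real.sq_sqrt (by positivity)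
  set e := √(∑ t : Fin T, (q' t.succ - q t.succ) ^ 2) with he
  have he0 : 0 ≤ e := Real.sqrt_nonneg _
  have hvt : ∀ t, |v t| ≤ η := fun t => Real.abs_le_sqrt
    (Finset.single_le_sum (f := fun t => v t ^ 2) (fun _ _ => sq_nonneg _) (Finset.mem_univ t))
  -- The baseline has entry `0` and mass `q 0`, so Cauchy–Schwarz over the other treatments leaves
  -- at least the fraction `q 0` of the second moment. Overlap is used once for this mass and once
  -- for the second moment.
  have hbase : pmin ^ 2 * η ^ 2 ≤ indexVar q v := by
    have hcs : (∑ t : Fin T, q t.succ * v t) ^ 2 ≤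
        (1 - q 0) * ∑ t : Fin T, q t.succ * v t ^ 2 := by
      rw [← hs]
      refine Finset.sum_sq_le_sum_mul_sum_of_sq_le_mul _ (fun t _ => hq0 _)
        (fun t _ => mul_nonneg (hq0 _) (sq_nonneg _)) (fun t _ => le_of_eq (by ring))
    have hlow : pmin * η ^ 2 ≤ ∑ t : Fin T, q t.succ * v t ^ 2 := by
      rw [hη2, Finset.mul_sum]
      exact Finset.sum_le_sum fun t _ => mul_le_mul_of_nonneg_right (hq _) (sq_nonneg _)
    unfold indexVar
    nlinarith [hq 0, mul_le_mul (hq 0) hlow (by positivity) (hq0 0)]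
  have hCS : ∑ t : Fin T, |q' t.succ - q t.succ| * |v t| ≤ e * η := by
    have := Real.sum_mul_le_sqrt_mul_sqrt Finset.univ (fun t : Fin T => |q' t.succ - q t.succ|)
      (fun t => |v t|)
    simpa only [sq_abs] using this
  have h1 : |∑ t : Fin T, (q' t.succ - q t.succ) * v t ^ 2| ≤ e * η ^ 2 := by
    calc _ ≤ ∑ t : Fin T, |(q' t.succ - q t.succ) * v t ^ 2| := Finset.abs_sum_le_sum_abs _ _
      _ ≤ ∑ t : Fin T, |q' t.succ - q t.succ| * |v t| * η := Finset.sum_le_sum fun t _ => by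
          rw [abs_mul, abs_pow, sq, ← mul_assoc]
          exact mul_le_mul_of_nonneg_left (hvt t) (by positivity)
      _ ≤ e * η * η := by
          rw [← Finset.sum_mul]; exact mul_le_mul_of_nonneg_right hCS hη0
      _ = _ := by ring
  have h2 : |∑ t : Fin T, (q' t.succ - q t.succ) * v t| ≤ e * η := by
    refine (Finset.abs_sum_le_sum_abs _ _).trans (le_trans (le_of_eq ?_) hCS)
    exact Finset.sum_congr rfl fun t _ => abs_mul _ _
  have h3 : ∀ r : Fin (T + 1) → ℝ, (∀ t, 0 ≤ r t) → ∑ t : Fin T, r t.succ = 1 - r 0 →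
      |∑ t : Fin T, r t.succ * v t| ≤ η := fun r hr hr1 => by
    calc _ ≤ ∑ t : Fin T, |r t.succ * v t| := Finset.abs_sum_le_sum_abs _ _
      _ ≤ ∑ t : Fin T, r t.succ * η := Finset.sum_le_sum fun t _ => by
          rw [abs_mul, abs_of_nonneg (hr _)]
          exact mul_le_mul_of_nonneg_left (hvt t) (hr _)
      _ = (1 - r 0) * η := by rw [← Finset.sum_mul, hr1]
      _ ≤ η := mul_le_of_le_one_left hη0 (by linarith [hr 0])
  have h4 : |(∑ t : Fin T, (q' t.succ - q t.succ) * v t) *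
      (∑ t : Fin T, q' t.succ * v t + ∑ t : Fin T, q t.succ * v t)| ≤ e * η * (2 * η) := by
    rw [abs_mul]
    refine mul_le_mul h2 ?_ (abs_nonneg _) (by positivity)
    refine (abs_add_le _ _).trans ?_
    linarith [h3 q hq0 hs, h3 q' hq' hs']
  have hdiff : indexVar q' v - indexVar q v =
      ∑ t : Fin T, (q' t.succ - q t.succ) * v t ^ 2 -
      (∑ t : Fin T, (q' t.succ - q t.succ) * v t) *
      (∑ t : Fin T, q' t.succ * v t + ∑ t : Fin T, q t.succ * v t) := by
    unfold indexVar
    simp_rw [sub_mul, Finset.sum_sub_distrib]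
    ring
  rw [← hη2]
  have := (abs_le.1 h1).1
  have := (abs_le.1 h4).2
  nlinarith

end Logit

/-! ### Empirical averages. -/

section EmpMean

variable {n : ℕ}

lemma empMean_add (f g : Fin n → ℝ) :
    empMean (fun i => f i + g i) = empMean f + empMean g := by
  simp [empMean, Finset.sum_add_distrib, add_div]

lemma empMean_sub (f g : Fin n → ℝ) :
    empMean (fun i => f i - g i) = empMean f - empMean g := by
  simp [empMean, Finset.sum_sub_distrib, sub_div]

lemma empMean_const_mul (a : ℝ) (f : Fin n → ℝ) :
    empMean (fun i => a * f i) = a * empMean f := by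
  simp [empMean, ← Finset.mul_sum, mul_div_assoc]

lemma empMean_sum {ι : Type*} (s : Finset ι) (f : ι → Fin n → ℝ) :
    empMean (fun i => ∑ t ∈ s, f t i) = ∑ t ∈ s, empMean (f t) := by
  simp only [empMean]
  rw [Finset.sum_comm, Finset.sum_div]

lemma empMean_mono {f g : Fin n → ℝ} (h : ∀ i, f i ≤ g i) : empMean f ≤ empMean g :=
  div_le_div_of_nonneg_right (Finset.sum_le_sum fun i _ => h i) (Nat.cast_nonneg n)

lemma empMean_nonneg {f : Fin n → ℝ} (h : ∀ i, 0 ≤ f i) : 0 ≤ empMean f :=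
  div_nonneg (Finset.sum_nonneg fun i _ => h i) (Nat.cast_nonneg n)

lemma empMean_const_le {a : ℝ} (ha : 0 ≤ a) : empMean (fun _ : Fin n => a) ≤ a := by
  rcases Nat.eq_zero_or_pos n with h | h
  · subst h; simpa [empMean] using ha
  · simp [empMean]; field_simp; exact le_rfl

lemma empMean_mul_le (f g : Fin n → ℝ) :
    empMean (fun i => f i * g i) ≤
      √(empMean fun i => f i ^ 2) * √(empMean fun i => g i ^ 2) := by
  unfold empMean
  rw [Real.sqrt_div' _ (Nat.cast_nonneg n), Real.sqrt_div' _ (Nat.cast_nonneg n),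
    div_mul_div_comm, Real.mul_self_sqrt (Nat.cast_nonneg n)]
  exact div_le_div_of_nonneg_right (Real.sum_mul_le_sqrt_mul_sqrt _ _ _) (Nat.cast_nonneg n)

lemma sqrt_empMean_add_sq_le (f g : Fin n → ℝ) :
    √(empMean fun i => (f i + g i) ^ 2) ≤
      √(empMean fun i => f i ^ 2) + √(empMean fun i => g i ^ 2) := by
  refine Real.sqrt_le_iff.2 ⟨by positivity, ?_⟩
  have h1 := empMean_mul_le f g
  have h2 := Real.sq_sqrt (empMean_nonneg (f := fun i => f i ^ 2) fun i => sq_nonneg _)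
  have h3 := Real.sq_sqrt (empMean_nonneg (f := fun i => g i ^ 2) fun i => sq_nonneg _)
  have h4 : (fun i => (f i + g i) ^ 2) = fun i => f i ^ 2 + (2 * (f i * g i) + g i ^ 2) := by
    ext i; ring
  rw [h4, empMean_add, empMean_add, empMean_const_mul]
  nlinarith

end EmpMean

/-! ### Linear indices, the prediction norm and sparse eigenvalues. -/

section Index

variable {n p T : ℕ} (x : Fin n → Fin p → ℝ)

lemma index_add (γ δ : Coef T p) (i : Fin n) :
    index x (γ + δ) i = index x γ i + index x δ i := by
  ext t; simp [index, mul_add, Finset.sum_add_distrib]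

lemma index_smul (τ : ℝ) (δ : Coef T p) (i : Fin n) :
    index x (τ • δ) i = τ • index x δ i := by
  ext t; simp [index, Finset.mul_sum, mul_left_comm]

/-- The squared prediction norm `𝔼ₙ[‖(xᵢ' δ_t)_t‖²]`. -/
noncomputable def predSq (δ : Coef T p) : ℝ := empMean fun i => ∑ t, index x δ i t ^ 2

lemma predSq_nonneg (δ : Coef T p) : 0 ≤ predSq x δ :=
  empMean_nonneg fun _ => Finset.sum_nonneg fun _ _ => sq_nonneg _

lemma predSq_smul (τ : ℝ) (δ : Coef T p) : predSq x (τ • δ) = τ ^ 2 * predSq x δ := by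
  unfold predSq
  rw [← empMean_const_mul]
  congr 1; ext i
  rw [index_smul, Finset.mul_sum]
  exact Finset.sum_congr rfl fun t _ => by simp; ring

lemma quadForm_gram (v : Fin p → ℝ) :
    quadForm (gram x) v = empMean fun i => (∑ j, x i j * v j) ^ 2 := by
  simp only [quadForm, dotProduct, Matrix.mulVec, gram, Matrix.of_apply]
  have : ∀ i, (∑ j, x i j * v j) ^ 2 = ∑ j, ∑ k, v j * (v k * (x i j * x i k)) := fun i => by
    rw [sq, Finset.sum_mul_sum]
    exact Finset.sum_congr rfl fun j _ => Finset.sum_congr rfl fun k _ => by ring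
  simp_rw [this]
  rw [empMean_sum]
  refine Finset.sum_congr rfl fun j _ => ?_
  rw [empMean_sum, Finset.mul_sum]
  refine Finset.sum_congr rfl fun k _ => ?_
  rw [empMean_const_mul, empMean_const_mul]; ring

lemma quadForm_gram_nonneg (v : Fin p → ℝ) : 0 ≤ quadForm (gram x) v := by
  rw [quadForm_gram]; exact empMean_nonneg fun _ => sq_nonneg _

lemma sum_quadForm_gram (δ : Coef T p) : ∑ t, quadForm (gram x) (δ t) = predSq x δ := by
  simp_rw [quadForm_gram]
  rw [predSq, empMean_sum]; rfl

lemma quadForm_gram_le_predSq (δ : Coef T p) (t : Fin T) :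
    quadForm (gram x) (δ t) ≤ predSq x δ := by
  rw [← sum_quadForm_gram]
  exact Finset.single_le_sum (f := fun t => quadForm (gram x) (δ t))
    (fun t _ => quadForm_gram_nonneg x (δ t)) (Finset.mem_univ t)

variable {x}

lemma sparseEigMin_sq_mul_le {S : Finset (Fin p)} (hφ : 0 < sparseEigMin (gram x) S)
    {v : Fin p → ℝ} (hv : ∀ j, j ∉ S → v j = 0) :
    sparseEigMin (gram x) S ^ 2 * ∑ j, v j ^ 2 ≤ quadForm (gram x) v := by
  by_cases h0 : v = 0
  · subst h0; simp [quadForm]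
  have hpos : 0 < ∑ j, v j ^ 2 := by
    refine lt_of_le_of_ne (Finset.sum_nonneg fun j _ => sq_nonneg _) fun h => h0 ?_
    ext j
    have := (Finset.sum_eq_zero_iff_of_nonneg fun j _ => sq_nonneg (v j)).1 h.symm j
      (Finset.mem_univ j)
    simpa using this
  unfold sparseEigMin at hφ ⊢
  rw [Real.sq_sqrt (Real.sqrt_pos.1 hφ).le, ← le_div_iff₀ hpos]
  refine csInf_le ⟨0, ?_⟩ ⟨v, h0, hv, rfl⟩
  rintro r ⟨δ, -, -, rfl⟩
  exact div_nonneg (quadForm_gram_nonneg x δ) (Finset.sum_nonneg fun j _ => sq_nonneg _)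

/-- No nonzero vector is supported in the empty set, and `sInf ∅ = 0`. This excludes the degenerate
case `S_D = ∅`. -/
lemma nonempty_of_sparseEigMin_pos {S : Finset (Fin p)} (hφ : 0 < sparseEigMin (gram x) S) :
    S.Nonempty := by
  by_contra h
  rw [Finset.not_nonempty_iff_eq_empty] at h
  subst h
  refine hφ.ne' ?_
  have : {r : ℝ | ∃ δ : Fin p → ℝ, δ ≠ 0 ∧ (∀ j, j ∉ (∅ : Finset (Fin p)) → δ j = 0) ∧
      r = quadForm (gram x) δ / ∑ j, δ j ^ 2} = ∅ := by
    ext r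
    simp only [Set.mem_ofPred_eq, Set.mem_empty_iff_false, iff_false]
    rintro ⟨δ, h1, h2, -⟩
    exact h1 (funext fun j => h2 j (by simp))
  rw [sparseEigMin, this]
  simp

/-- Turns the average control of sparse indices into uniform control over observations, which the
local estimates for the logit require. -/
lemma sum_sq_index_le {X : ℝ} (hX : ∀ i j, |x i j| ≤ X) {S : Finset (Fin p)}
    (hφ : 0 < sparseEigMin (gram x) S) {δ : Coef T p} (hδ : ∀ t, ∀ j, j ∉ S → δ t j = 0)
    (i : Fin n) :
    ∑ t, index x δ i t ^ 2 ≤ (X * √S.card * √(predSq x δ) / sparseEigMin (gram x) S) ^ 2 := by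
  set φ := sparseEigMin (gram x) S with hφd
  rw [div_pow, mul_pow, mul_pow, Real.sq_sqrt (Nat.cast_nonneg _),
    Real.sq_sqrt (predSq_nonneg x δ), le_div_iff₀ (by positivity), ← sum_quadForm_gram,
    Finset.mul_sum, Finset.sum_mul]
  refine Finset.sum_le_sum fun t _ => ?_
  have h1 : index x δ i t = ∑ j ∈ S, x i j * δ t j := by
    refine (Finset.sum_subset (Finset.subset_univ S) fun j _ hj => ?_).symm
    rw [hδ t j hj, mul_zero]
  have h2 : (∑ j ∈ S, x i j * δ t j) ^ 2 ≤ (X ^ 2 * S.card) * ∑ j, δ t j ^ 2 := by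
    calc _ ≤ (∑ j ∈ S, x i j ^ 2) * ∑ j ∈ S, δ t j ^ 2 := Finset.sum_mul_sq_le_sq_mul_sq _ _ _
      _ ≤ (∑ j ∈ S, X ^ 2) * ∑ j, δ t j ^ 2 := by
          refine mul_le_mul (Finset.sum_le_sum fun j _ => ?_)
            (Finset.sum_le_sum_of_subset_of_nonneg (Finset.subset_univ _)
              fun _ _ _ => sq_nonneg _) (by positivity) (by positivity)
          exact sq_le_sq' (abs_le.1 (hX i j)).1 (abs_le.1 (hX i j)).2
      _ = _ := by simp; left; ring
  rw [h1]
  calc _ ≤ (X ^ 2 * S.card) * (∑ j, δ t j ^ 2) * φ ^ 2 :=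
        mul_le_mul_of_nonneg_right h2 (sq_nonneg _)
    _ = (X ^ 2 * S.card) * (φ ^ 2 * ∑ j, δ t j ^ 2) := by ring
    _ ≤ _ := mul_le_mul_of_nonneg_left (sparseEigMin_sq_mul_le hφ (hδ t)) (by positivity)

lemma sum_abs_le {S : Finset (Fin p)} (hφ : 0 < sparseEigMin (gram x) S) {δ : Coef T p}
    (hδ : ∀ t, ∀ j, j ∉ S → δ t j = 0) (t : Fin T) :
    ∑ j, |δ t j| ≤ √S.card / sparseEigMin (gram x) S * √(predSq x δ) := by
  set φ := sparseEigMin (gram x) S with hφd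
  have h1 : ∑ j, |δ t j| = ∑ j ∈ S, 1 * |δ t j| := by
    simp_rw [one_mul]
    refine (Finset.sum_subset (Finset.subset_univ S) fun j _ hj => ?_).symm
    rw [hδ t j hj, abs_zero]
  have h2 := Real.sum_mul_le_sqrt_mul_sqrt S (fun _ => 1) (fun j => |δ t j|)
  have h3 : √(∑ j ∈ S, |δ t j| ^ 2) ≤ √(predSq x δ) / φ := by
    rw [le_div_iff₀ hφ]
    refine Real.le_sqrt_of_sq_le ?_
    rw [mul_pow, Real.sq_sqrt (by positivity)]
    refine le_trans ?_ (quadForm_gram_le_predSq x δ t)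
    refine le_trans ?_ (sparseEigMin_sq_mul_le hφ (hδ t))
    rw [mul_comm]
    refine mul_le_mul_of_nonneg_left ?_ (sq_nonneg _)
    simp_rw [sq_abs]
    exact Finset.sum_le_sum_of_subset_of_nonneg (Finset.subset_univ _) fun _ _ _ => sq_nonneg _
  rw [h1]
  refine h2.trans ?_
  calc _ ≤ √S.card * (√(predSq x δ) / φ) := by
        refine mul_le_mul (by simp) h3 (by positivity) (by positivity)
    _ = _ := by ring

end Index

/-! ### Expansion of the loss, and its local strong convexity. -/

section Loss

variable {n p T : ℕ} (x : Fin n → Fin p → ℝ) (d : Fin n → Fin (T + 1))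

/-- The Bregman divergence of the multinomial logistic loss at `γ`, in the direction `δ`. -/
noncomputable def lossBregman (γ δ : Coef T p) : ℝ := empMean fun i => bregman (index x γ i) (index x δ i)

/-- The directional derivative of the multinomial logistic loss at `γ`, in the direction `δ`. -/
noncomputable def lossDeriv (γ δ : Coef T p) : ℝ :=
  empMean fun i => ∑ t : Fin T,
    (mlogit (index x γ i) t.succ - if d i = t.succ then 1 else 0) * index x δ i t

lemma withBaseline_apply (v : Fin T → ℝ) (r : Fin (T + 1)) :
    withBaseline v r = ∑ t : Fin T, (if r = t.succ then 1 else 0) * v t := by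
  refine Fin.cases ?_ (fun s => ?_) r
  · simp [withBaseline, (Fin.succ_ne_zero _).symm]
  · simp [withBaseline]

lemma loss_eq (γ : Coef T p) :
    loss x d γ =
      empMean fun i => logPartition (index x γ i) - withBaseline (index x γ i) (d i) := by
  unfold loss
  rw [← empMean_sum]
  congr 1; ext i
  rw [Finset.sum_eq_single (d i) (fun t _ ht => by simp [ht.symm]) (by simp)]
  rw [log_mlogit]; simp

/-- The treatments enter the loss linearly in the index, so they appear in the derivative only and
the remainder is purely a divergence. -/
lemma loss_add (γ δ : Coef T p) :
    loss x d (γ + δ) = loss x d γ + lossBregman x γ δ + lossDeriv x d γ δ := by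
  rw [loss_eq, loss_eq, lossBregman, lossDeriv, ← empMean_add, ← empMean_add]
  congr 1; ext i
  have h : withBaseline (index x (γ + δ) i) (d i) =
      withBaseline (index x γ i) (d i) + withBaseline (index x δ i) (d i) := by
    simp_rw [withBaseline_apply, index_add, Pi.add_apply, mul_add, Finset.sum_add_distrib]
  rw [h, withBaseline_apply (index x δ i), index_add, bregman]
  simp_rw [sub_mul, Finset.sum_sub_distrib]
  ring

lemma lossBregman_smul_le (γ δ : Coef T p) {τ : ℝ} (h0 : 0 < τ) (h1 : τ ≤ 1) :
    lossBregman x γ (τ • δ) ≤ τ * lossBregman x γ δ := by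
  unfold lossBregman
  rw [← empMean_const_mul]
  exact empMean_mono fun i => by rw [index_smul]; exact bregman_smul_le _ _ h0 h1

/-- A self-normalized bound for the noise `𝟙{d = t} - p_t`, uniform over the coefficients that use
at most `k` covariates. -/
def NoiseBound (pr : Fin n → Fin (T + 1) → ℝ) (k : ℕ) (ν : ℝ) : Prop :=
  ∀ S : Finset (Fin p), S.card ≤ k → ∀ δ : Coef T p, (∀ t, ∀ j, j ∉ S → δ t j = 0) →
    |empMean fun i => ∑ t : Fin T,
      ((if d i = t.succ then 1 else 0) - pr i t.succ) * index x δ i t| ≤ ν * √(predSq x δ)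

variable {x d} {pr : Fin n → Fin (T + 1) → ℝ} {γ : Coef T p} {b : ℝ}

lemma sqrt_empMean_bias_le (hb0 : 0 ≤ b) (hb : ∀ t : Fin T, propError x pr γ t.succ ≤ b) :
    √(empMean fun i => ∑ t : Fin T, (mlogit (index x γ i) t.succ - pr i t.succ) ^ 2) ≤
      b * √T := by
  rw [empMean_sum]
  have h : ∀ t : Fin T,
      (empMean fun i => (mlogit (index x γ i) t.succ - pr i t.succ) ^ 2) ≤ b ^ 2 := fun t => by
    have h1 := hb t
    unfold propError at h1
    exact (Real.sqrt_le_left hb0).1 h1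
  refine Real.sqrt_le_iff.2 ⟨by positivity, ?_⟩
  rw [mul_pow, Real.sq_sqrt (Nat.cast_nonneg _)]
  refine (Finset.sum_le_sum fun t _ => h t).trans (le_of_eq ?_)
  simp; ring

lemma abs_lossDeriv_le (hb0 : 0 ≤ b) (hb : ∀ t : Fin T, propError x pr γ t.succ ≤ b) {k : ℕ}
    {ν : ℝ} (hν : NoiseBound x d pr k ν) {S : Finset (Fin p)} (hS : S.card ≤ k) {δ : Coef T p}
    (hδ : ∀ t, ∀ j, j ∉ S → δ t j = 0) :
    |lossDeriv x d γ δ| ≤ (b * √T + ν) * √(predSq x δ) := by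
  have h1 := hν S hS δ hδ
  have h2 : lossDeriv x d γ δ =
      (empMean fun i => ∑ t : Fin T,
        (mlogit (index x γ i) t.succ - pr i t.succ) * index x δ i t) -
      empMean fun i => ∑ t : Fin T,
        ((if d i = t.succ then 1 else 0) - pr i t.succ) * index x δ i t := by
    rw [lossDeriv, ← empMean_sub]
    congr 1; ext i
    rw [← Finset.sum_sub_distrib]
    exact Finset.sum_congr rfl fun t _ => by ring
  have h3 : |empMean fun i => ∑ t : Fin T,
      (mlogit (index x γ i) t.succ - pr i t.succ) * index x δ i t| ≤
      b * √T * √(predSq x δ) := by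
    have hcs : ∀ i, |∑ t : Fin T,
        (mlogit (index x γ i) t.succ - pr i t.succ) * index x δ i t| ≤
        √(∑ t : Fin T, (mlogit (index x γ i) t.succ - pr i t.succ) ^ 2) *
          √(∑ t, index x δ i t ^ 2) := fun i => by
      rw [← Real.sqrt_mul (by positivity)]
      exact Real.abs_le_sqrt (Finset.sum_mul_sq_le_sq_mul_sq _ _ _)
    have habs : ∀ f : Fin n → ℝ, |empMean f| ≤ empMean fun i => |f i| := fun f => by
      unfold empMean
      rw [abs_div, Nat.abs_cast]
      exact div_le_div_of_nonneg_right (Finset.abs_sum_le_sum_abs _ _) (Nat.cast_nonneg n)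
    refine (habs _).trans ((empMean_mono hcs).trans ((empMean_mul_le _ _).trans ?_))
    have e1 : ∀ i, √(∑ t : Fin T, (mlogit (index x γ i) t.succ - pr i t.succ) ^ 2) ^ 2 =
        ∑ t : Fin T, (mlogit (index x γ i) t.succ - pr i t.succ) ^ 2 := fun i =>
      Real.sq_sqrt (by positivity)
    have e2 : ∀ i, √(∑ t, index x δ i t ^ 2) ^ 2 = ∑ t, index x δ i t ^ 2 := fun i =>
      Real.sq_sqrt (by positivity)
    simp_rw [e1, e2]
    exact mul_le_mul_of_nonneg_right (sqrt_empMean_bias_le hb0 hb) (Real.sqrt_nonneg _)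
  rw [h2]
  refine (abs_sub _ _).trans ?_
  linarith

/-- Quadratic lower bound for the loss in a neighbourhood of a small-bias coefficient. -/
lemma le_lossBregman {X pmin c x0 : ℝ} (hX0 : 0 ≤ X) (hX : ∀ i j, |x i j| ≤ X)
    (hpmin : 0 ≤ pmin) (hpr : ∀ i t, pmin ≤ pr i t) (hpr1 : ∀ i, ∑ t, pr i t = 1)
    (hb0 : 0 ≤ b) (hb : ∀ t : Fin T, propError x pr γ t.succ ≤ b)
    {S : Finset (Fin p)} (hφ : 0 < sparseEigMin (gram x) S)
    (hc0 : 0 ≤ c) (hc : c ≤ pmin ^ 2)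
    (hx0 : X * √S.card * x0 / sparseEigMin (gram x) S ≤ 1 / 4)
    (hbc : b * √T * (X * √S.card / sparseEigMin (gram x) S) ≤ c / 64)
    {δ : Coef T p} (hδ : ∀ t, ∀ j, j ∉ S → δ t j = 0) (hq : √(predSq x δ) ≤ x0) :
    c / 4 * predSq x δ ≤ lossBregman x γ δ := by
  set φ := sparseEigMin (gram x) S with hφd
  set r := √(predSq x δ) with hr
  have hr0 : 0 ≤ r := Real.sqrt_nonneg _
  have hr2 : r ^ 2 = predSq x δ := Real.sq_sqrt (predSq_nonneg x δ)
  set M := X * √S.card * r / φ with hM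
  have hM0 : 0 ≤ M := by positivity
  have hMle : M ≤ 1 / 4 := le_trans (by rw [hM]; gcongr) hx0
  have hv : ∀ i, ∑ t, index x δ i t ^ 2 ≤ M ^ 2 := sum_sq_index_le hX hφ hδ
  set e : Fin n → ℝ := fun i =>
    √(∑ t : Fin T, (mlogit (index x γ i) t.succ - pr i t.succ) ^ 2) with he
  set w : Fin n → ℝ := fun i => √(∑ t, index x δ i t ^ 2) with hw
  have hw2 : ∀ i, w i ^ 2 = ∑ t, index x δ i t ^ 2 := fun i => Real.sq_sqrt (by positivity)
  have he2 : ∀ i, e i ^ 2 = ∑ t : Fin T, (mlogit (index x γ i) t.succ - pr i t.succ) ^ 2 :=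
    fun i => Real.sq_sqrt (by positivity)
  have hwM : ∀ i, w i ≤ M := fun i => Real.sqrt_le_iff.2 ⟨hM0, hv i⟩
  -- The error from replacing the true probabilities is of order `e * w ^ 2`. One factor `w` is
  -- bounded by `M`, so that Cauchy–Schwarz can be applied to the average of `e * w`.
  have h1 : ∀ i, 9 / 25 * (pmin ^ 2 * w i ^ 2) - 27 / 25 * M * (e i * w i) ≤
      bregman (index x γ i) (index x δ i) := fun i => by
    have hb1 := le_bregman (index x γ i) (index x δ i) ((hv i).trans (by nlinarith))
    have hb2 := le_indexVar (pr i) (mlogit (index x γ i)) (index x δ i) hpmin (hpr i) (hpr1 i)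
      (fun t => (mlogit_pos _ t).le) (sum_mlogit _)
    rw [← hw2] at hb2
    change pmin ^ 2 * w i ^ 2 - 3 * e i * w i ^ 2 ≤ _ at hb2
    have hw0 : 0 ≤ w i := Real.sqrt_nonneg _
    have he0 : 0 ≤ e i := Real.sqrt_nonneg _
    have := mul_le_mul_of_nonneg_left (hwM i) (mul_nonneg he0 hw0)
    nlinarith
  have h2 := empMean_mono h1
  rw [empMean_sub, empMean_const_mul, empMean_const_mul, empMean_const_mul] at h2
  have h3 : (empMean fun i => e i * w i) ≤ b * √T * r := by
    refine (empMean_mul_le e w).trans ?_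
    simp_rw [hw2, he2]
    exact mul_le_mul_of_nonneg_right (sqrt_empMean_bias_le hb0 hb) (Real.sqrt_nonneg _)
  simp_rw [hw2] at h2
  change 9 / 25 * (pmin ^ 2 * predSq x δ) - _ ≤ lossBregman x γ δ at h2
  rw [← hr2] at h2 ⊢
  have h4 : M * (b * √T * r) ≤ c / 64 * r ^ 2 := by
    calc M * (b * √T * r) = b * √T * (X * √S.card / φ) * r ^ 2 := by rw [hM]; ring
      _ ≤ _ := mul_le_mul_of_nonneg_right hbc (sq_nonneg _)
  have h5 := mul_le_mul_of_nonneg_left h3 hM0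
  have h6 := mul_le_mul_of_nonneg_right hc (sq_nonneg r)
  -- `9/25 - 27/25 * 1/64 > 1/4`.
  nlinarith [mul_nonneg hc0 (sq_nonneg r)]

end Loss

/-! ### Consequences of the conditions on the constants. -/

lemma Ap_div {pmin b : ℝ} (hpmin : 0 < pmin) (hb : b < pmin) :
    Ap pmin b / pmin = (pmin - b)⁻¹ := by
  rw [Ap, max_eq_right (by linarith)]
  have : pmin - b ≠ 0 := by linarith
  field_simp

/-- A prediction norm below the group lasso rate, large compared with noise and bias, up to which
the loss is strongly convex. -/
lemma RateConditions.exists_level {T s k : ℕ} {X lam pmin b κ φ A : ℝ}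
    (h : RateConditions T s k X lam pmin b κ φ A) (hT : 1 ≤ T) (hs : 1 ≤ s) (hX : 0 < X)
    (hlam : 0 < lam) (hb : 0 ≤ b) :
    ∃ x0, 0 < x0 ∧ x0 ≤ RM T s lam pmin b κ A ∧ X * √k * x0 / φ ≤ 1 / 4 ∧
      b * √T * (X * √k / φ) ≤ (pmin - b) ^ (T + 1) / 64 ∧
      12 * (lam * √s / κ + b * √T) ≤ (pmin - b) ^ (T + 1) * x0 := by
  obtain ⟨hbp, hκ, hφ, hd, -, hd2, hA, hA2⟩ := h
  have hpmin : 0 < pmin := hb.trans_lt hbp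
  -- The lasso denominator is `κ ^ 2` minus a nonnegative term.
  have hA0 : 2 < A := by
    refine lt_of_le_of_lt ?_ hA
    rw [← div_eq_mul_inv, le_div_iff₀ hd]
    have : lassoDen T s X lam b κ ≤ κ ^ 2 := by
      unfold lassoDen
      have : 0 ≤ 2 / 3 * X * √T *
          (30 * lam * s + 100 * √s * κ * b * √T + 80 * κ ^ 2 * b ^ 2 * T * lam⁻¹) := by
        positivity
      linarith
    linarith
  set R := RM T s lam pmin b κ A with hR
  set c := (pmin - b) ^ (T + 1) with hc
  have hc0 : 0 < c := pow_pos (by linarith) _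
  set ℓ := lam * √s / κ with hℓ
  have hℓ0 : 0 < ℓ := by
    have : (0 : ℝ) < s := by exact_mod_cast hs
    positivity
  have hT1 : (1 : ℝ) ≤ T := by exact_mod_cast hT
  have hsT : 1 ≤ √(T : ℝ) := Real.one_le_sqrt.2 hT1
  set β := b * √T with hβ
  have hβ0 : 0 ≤ β := by positivity
  have hRe : R = c⁻¹ * T * A * (6 * ℓ + 8 * β) := by
    rw [hR, RM, Ap_div hpmin hbp, inv_pow]
    ring
  -- The value of `R_ℳ` at `A = 2`.
  set x0 := c⁻¹ * T * (12 * ℓ + 16 * β) with hx0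
  have hx0p : 0 < x0 := by positivity
  have hRx : R = A / 2 * x0 := by rw [hRe, hx0]; ring
  have hmain : X * √k * x0 ≤ φ / 4 := by
    have h1 := lt_of_le_of_lt (le_max_right _ _) hA2
    rw [div_lt_iff₀ hd2, refitDen₂] at h1
    set Y := X * √k * x0 with hY
    have hY0 : 0 ≤ Y := by positivity
    have h2 : 2 * R * X * √T * √k = A * (Y * √T) := by rw [hRx, hY]; ring
    rw [h2] at h1
    have h3 : Y ≤ Y * √T := le_mul_of_one_le_right hY0 hsT
    have h4 : A * (A * Y) ≤ (A - 1) * φ := by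
      have := mul_le_mul_of_nonneg_left h3 (by positivity : 0 ≤ A * A)
      nlinarith
    -- `A - 1 ≤ A ^ 2 / 4` is `(A - 2) ^ 2 ≥ 0`.
    have h5 : A * (A * Y) ≤ A * (A * (φ / 4)) := by nlinarith [sq_nonneg (A - 2)]
    exact le_of_mul_le_mul_left (le_of_mul_le_mul_left h5 (by linarith)) (by linarith)
  have hx0ge : c⁻¹ * (12 * ℓ + 16 * β) ≤ x0 := by
    rw [hx0, mul_right_comm]
    exact le_mul_of_one_le_right (by positivity) hT1
  have hcx : 12 * ℓ + 16 * β ≤ c * x0 := by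
    have := mul_le_mul_of_nonneg_left hx0ge hc0.le
    rwa [mul_inv_cancel_left₀ hc0.ne'] at this
  refine ⟨x0, hx0p, ?_, ?_, ?_, ?_⟩
  · rw [hRx]; nlinarith
  · rw [div_le_iff₀ hφ]; linarith
  · rw [← mul_div_assoc, div_le_iff₀ hφ]
    have h1 : 16 * β ≤ c * x0 := by linarith
    have h2 : 0 ≤ X * √k := by positivity
    have h3 := mul_le_mul_of_nonneg_right h1 h2
    have h4 := mul_le_mul_of_nonneg_left hmain hc0.le
    nlinarith
  · linarith

/-! ### Deterministic error bounds for the lasso and the refit. -/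

section Bounds

variable {n p T : ℕ} {x : Fin n → Fin p → ℝ}

lemma groupNormOn_le_sqrt_card_mul (S : Finset (Fin p)) (δ : Coef T p) :
    groupNormOn S δ ≤ √S.card * √(∑ t, ∑ j ∈ S, δ t j ^ 2) := by
  unfold groupNormOn
  have h := Real.sum_mul_le_sqrt_mul_sqrt S (fun _ => 1) (fun j => √(∑ t, δ t j ^ 2))
  have e : ∀ j, √(∑ t, δ t j ^ 2) ^ 2 = ∑ t, δ t j ^ 2 := fun j => Real.sq_sqrt (by positivity)
  simp_rw [e] at h
  rw [Finset.sum_comm] at h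
  simpa using h

lemma groupNormOn_nonneg (S : Finset (Fin p)) (δ : Coef T p) : 0 ≤ groupNormOn S δ :=
  Finset.sum_nonneg fun _ _ => Real.sqrt_nonneg _

lemma IsRestrictedEigBound.groupNormOn_le {S : Finset (Fin p)} {κ : ℝ} (hκ : 0 < κ)
    (h : IsRestrictedEigBound T (gram x) S κ) {δ : Coef T p}
    (hc : groupNormOn Sᶜ δ ≤ 4 * groupNormOn S δ) :
    groupNormOn S δ ≤ √S.card / κ * √(predSq x δ) := by
  by_cases h0 : δ = 0
  · subst h0
    have : groupNormOn S (0 : Coef T p) = 0 := by simp [groupNormOn]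
    rw [this]; positivity
  have h1 := h δ h0 hc
  rw [sum_quadForm_gram] at h1
  have hpos : 0 < ∑ t, ∑ j ∈ S, δ t j ^ 2 := by
    refine lt_of_le_of_ne (by positivity) fun h2 => ?_
    rw [← h2, div_zero] at h1
    nlinarith
  rw [le_div_iff₀ hpos] at h1
  refine (groupNormOn_le_sqrt_card_mul S δ).trans ?_
  rw [div_mul_eq_mul_div, mul_div_assoc]
  refine mul_le_mul_of_nonneg_left ?_ (Real.sqrt_nonneg _)
  rw [le_div_iff₀ hκ]
  refine Real.le_sqrt_of_sq_le ?_
  rw [mul_pow, Real.sq_sqrt hpos.le]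
  linarith

/-- Test the eigenvalue bound on a single coordinate of `S`. This lets a noise level stated with `X`
be absorbed into the rate stated with `κ`. -/
lemma IsRestrictedEigBound.le_of_abs_le (hT : 1 ≤ T) {S : Finset (Fin p)} (hS : S.Nonempty)
    {κ X : ℝ} (h : IsRestrictedEigBound T (gram x) S κ) (hX0 : 0 ≤ X)
    (hX : ∀ i j, |x i j| ≤ X) : κ ≤ X := by
  obtain ⟨j0, hj0⟩ := hS
  set t0 : Fin T := ⟨0, hT⟩
  set δ : Coef T p := fun t j => if t = t0 ∧ j = j0 then 1 else 0 with hδ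
  have h0 : δ ≠ 0 := fun h => by
    have := congrFun (congrFun h t0) j0
    simp [hδ] at this
  have hsq : ∀ t j, δ t j ^ 2 = if t = t0 ∧ j = j0 then 1 else 0 := fun t j => by
    simp only [hδ]; split_ifs <;> simp
  have hc : groupNormOn Sᶜ δ = 0 := by
    refine Finset.sum_eq_zero fun j hj => ?_
    have : j ≠ j0 := fun h => by subst h; simp [hj0] at hj
    simp [hsq, this]
  have h1 := h δ h0 (by rw [hc]; have := groupNormOn_nonneg S δ; positivity)
  have h2 : ∑ t, ∑ j ∈ S, δ t j ^ 2 = 1 := by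
    simp_rw [hsq, ite_and]
    simp [hj0]
  rw [h2, div_one, sum_quadForm_gram] at h1
  have h3 : ∀ i, ∑ t, index x δ i t ^ 2 = x i j0 ^ 2 := fun i => by
    have : ∀ t, index x δ i t = if t = t0 then x i j0 else 0 := fun t => by
      simp only [index, hδ, mul_ite, mul_one, mul_zero, ite_and]
      split_ifs <;> simp
    simp [this]
  have h4 : predSq x δ ≤ X ^ 2 := by
    unfold predSq
    simp_rw [h3]
    refine (empMean_mono fun i => ?_).trans (empMean_const_le (sq_nonneg X))
    exact sq_le_sq' (abs_le.1 (hX i j0)).1 (abs_le.1 (hX i j0)).2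
  exact le_of_sq_le_sq (h1.trans h4) hX0

/-- Decomposability of the penalty: off the support of `γ` the whole of `γ' - γ` counts against
`γ'`, and on the support the triangle inequality applies column by column. -/
lemma groupNorm_sub_le (γ γ' : Coef T p) :
    groupNorm γ - groupNorm γ' ≤ groupNormOn (groupSupport γ) (γ' - γ) -
      groupNormOn (groupSupport γ)ᶜ (γ' - γ) := by
  classical
  set S := groupSupport γ with hS
  have hz : ∀ j ∈ Sᶜ, ∀ t, γ t j = 0 := fun j hj t => by
    by_contra h
    simp only [hS, Finset.mem_compl, groupSupport, Finset.mem_filter, Finset.mem_univ,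
      true_and, not_exists, not_not] at hj
    exact h (hj t)
  have hsplit : ∀ δ : Coef T p, groupNorm δ = groupNormOn S δ + groupNormOn Sᶜ δ := fun δ =>
    (Finset.sum_add_sum_compl S _).symm
  have h1 : groupNormOn Sᶜ γ = 0 := Finset.sum_eq_zero fun j hj => by simp [hz j hj]
  have h2 : groupNormOn Sᶜ (γ' - γ) = groupNormOn Sᶜ γ' :=
    Finset.sum_congr rfl fun j hj => by simp [hz j hj]
  have h3 : groupNormOn S γ ≤ groupNormOn S γ' + groupNormOn S (γ' - γ) := by
    unfold groupNormOn
    rw [← Finset.sum_add_distrib]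
    refine Finset.sum_le_sum fun j _ => ?_
    have hn : ∀ v : Fin T → ℝ, √(∑ t, v t ^ 2) = ‖WithLp.toLp 2 v‖ := fun v => by
      simp [EuclideanSpace.norm_eq]
    have hf : (fun t => γ t j) = (fun t => γ' t j) - fun t => (γ' - γ) t j := by ext t; simp
    rw [hn, hn, hn, hf, WithLp.toLp_sub]
    exact norm_sub_le _ _
  rw [hsplit γ, hsplit γ', h1, h2]
  linarith

/-- The prediction norm of any direction with small loss divergence is small. -/
lemma sqrt_predSq_le_of_lossBregman {γ : Coef T p} {S : Finset (Fin p)} {c x0 u v x1 : ℝ}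
    (hx0 : 0 < x0) (hx1 : 0 ≤ x1) (hv : 0 ≤ v)
    (hB : ∀ δ : Coef T p, (∀ t, ∀ j, j ∉ S → δ t j = 0) → √(predSq x δ) ≤ x0 →
      c / 4 * predSq x δ ≤ lossBregman x γ δ)
    {δ : Coef T p} (hδ : ∀ t, ∀ j, j ∉ S → δ t j = 0)
    (hle : lossBregman x γ δ ≤ u * √(predSq x δ) + v)
    (hx : ∀ r, x1 < r → r ≤ x0 → u * r + v < c / 4 * r ^ 2) (hx10 : x1 < x0) :
    √(predSq x δ) ≤ x1 := by
  by_contra! hcon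
  set r := √(predSq x δ) with hr
  have hr0 : 0 < r := hx1.trans_lt hcon
  -- If `r` exceeded `x1`, shrink the direction to length `r'`, inside the region of strong
  -- convexity. The divergence shrinks at least proportionally, so the linear upper bound survives
  -- and contradicts the quadratic lower bound there.
  set r' := min r x0 with hr'
  have hr'0 : 0 < r' := lt_min hr0 hx0
  set τ := r' / r with hτ
  have hτ0 : 0 < τ := by positivity
  have hτ1 : τ ≤ 1 := (div_le_one hr0).2 (min_le_left _ _)
  have hτr : τ * r = r' := div_mul_cancel₀ _ hr0.ne'
  have h1 := lossBregman_smul_le x γ δ hτ0 hτ1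
  have h2 : √(predSq x (τ • δ)) = r' := by
    rw [predSq_smul, Real.sqrt_mul (sq_nonneg _), Real.sqrt_sq hτ0.le, hτr]
  have h3 := hB (τ • δ) (fun t j hj => by simp [hδ t j hj]) (by rw [h2]; exact min_le_right _ _)
  have h4 : predSq x (τ • δ) = r' ^ 2 := by rw [← h2, Real.sq_sqrt (predSq_nonneg x _)]
  rw [h4] at h3
  have h5 := hx r' (lt_min hcon hx10) (min_le_right _ _)
  have h6 := mul_le_mul_of_nonneg_left hle hτ0.le
  have h7 : τ * (u * r + v) = u * r' + τ * v := by rw [← hτr]; ring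
  linarith [mul_le_of_le_one_left hv hτ1]

lemma eq_zero_of_groupSupport_subset {γ : Coef T p} {S : Finset (Fin p)}
    (h : groupSupport γ ⊆ S) (t : Fin T) (j : Fin p) (hj : j ∉ S) : γ t j = 0 := by
  by_contra h0
  refine hj (h ?_)
  simp only [groupSupport, Finset.mem_filter, Finset.mem_univ, true_and]
  exact ⟨t, h0⟩

/-- The basic inequality of the group lasso. -/
lemma IsGroupLasso.lossBregman_le {d : Fin n → Fin (T + 1)} {γs γt : Coef T p} {lam κ β : ℝ}
    (hlam : 0 ≤ lam) (hκ : 0 < κ) (hRE : IsRestrictedEigBound T (gram x) (groupSupport γs) κ)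
    (h : IsGroupLasso x d lam γt)
    (hD : |lossDeriv x d γs (γt - γs)| ≤ β * √(predSq x (γt - γs))) :
    lossBregman x γs (γt - γs) ≤
      (lam * √(groupSupport γs).card / κ + β) * √(predSq x (γt - γs)) := by
  have h1 := h γs
  have hlt := loss_add x d γs (γt - γs)
  rw [add_sub_cancel] at hlt
  have h2 := groupNorm_sub_le γs γt
  have h3 := (abs_le.1 hD).1
  generalize groupSupport γs = S at *
  have h5 := groupNormOn_nonneg S (γt - γs)
  have h5' := groupNormOn_nonneg Sᶜ (γt - γs)
  have h4 : groupNormOn S (γt - γs) - groupNormOn Sᶜ (γt - γs) ≤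
      √S.card / κ * √(predSq x (γt - γs)) := by
    -- Outside the cone the left side is already nonpositive, so the eigenvalue bound is needed only
    -- inside it.
    by_cases hcone : groupNormOn Sᶜ (γt - γs) ≤ 4 * groupNormOn S (γt - γs)
    · have := hRE.groupNormOn_le hκ hcone
      linarith
    · have : 0 ≤ √S.card / κ * √(predSq x (γt - γs)) := by positivity
      linarith
  have h6 := mul_le_mul_of_nonneg_left (h2.trans h4) hlam
  have h7 : lam * (√S.card / κ * √(predSq x (γt - γs))) =
    lam * √S.card / κ * √(predSq x (γt - γs)) := by ring
  rw [h7] at h6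
  rw [add_mul]
  linarith

/-- Two quadratic inequalities are solved in turn: the lasso inequality yields `y = 7Λ/c`, which is
then a constant in the refit inequality. The slack in `12 * Λ ≤ c * x0` keeps both solutions inside
the radius `x0`. -/
lemma sqrt_predSq_le_of_basic_inequalities {γ δt δh : Coef T p} {S : Finset (Fin p)}
    {c x0 Λ : ℝ} (hx0 : 0 < x0) (hc0 : 0 < c) (hΛ0 : 0 < Λ) (hΛ : 12 * Λ ≤ c * x0)
    (hB : ∀ δ : Coef T p, (∀ t, ∀ j, j ∉ S → δ t j = 0) → √(predSq x δ) ≤ x0 →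
      c / 4 * predSq x δ ≤ lossBregman x γ δ)
    (hδt : ∀ t, ∀ j, j ∉ S → δt t j = 0) (hδh : ∀ t, ∀ j, j ∉ S → δh t j = 0)
    (hBt : lossBregman x γ δt ≤ 7 / 4 * Λ * √(predSq x δt))
    (hBh : lossBregman x γ δh ≤
      lossBregman x γ δt + Λ * √(predSq x δt) + Λ * √(predSq x δh)) :
    √(predSq x δh) ≤ x0 := by
  set y := 7 * Λ / c with hy
  have hy0 : 0 < y := by positivity
  have hcy : c * y = 7 * Λ := mul_div_cancel₀ _ hc0.ne'
  have hyx : y < x0 := lt_of_mul_lt_mul_left (a := c) (by linarith) hc0.le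
  have hxt : √(predSq x δt) ≤ y := by
    refine sqrt_predSq_le_of_lossBregman hx0 hy0.le le_rfl hB hδt
      (by linarith : _ ≤ 7 / 4 * Λ * √(predSq x δt) + 0) (fun r hr _ => ?_) hyx
    have h1 : c * y < c * r := mul_lt_mul_of_pos_left hr hc0
    have h2 : r * (c * y) < r * (c * r) := mul_lt_mul_of_pos_left h1 (by linarith)
    rw [hcy] at h2
    linarith
  have hBh' : lossBregman x γ δh ≤ Λ * √(predSq x δh) + 11 / 4 * Λ * y := by
    have := mul_le_mul_of_nonneg_left hxt hΛ0.le
    linarith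
  -- With `r = θ y` and `c y = 7Λ`, equality means `7θ² - 4θ - 11 = 0`, with positive root `22/14`.
  -- The value `23/14` corresponds to `23Λ/(2c)`, still below `12Λ/c`.
  have hxh : √(predSq x δh) ≤ 23 / 14 * y := by
    refine sqrt_predSq_le_of_lossBregman hx0 (by positivity) (by positivity) hB hδh hBh'
      (fun r hr _ => ?_) (lt_of_mul_lt_mul_left (a := c) (by linarith) hc0.le)
    have h1 : c * (23 / 14 * y) < c * r := mul_lt_mul_of_pos_left hr hc0
    have h2 : r * (c * (23 / 14 * y)) < r * (c * r) :=
      mul_lt_mul_of_pos_left h1 (by linarith)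
    have h3 : r * (c * (23 / 14 * y)) = 23 / 2 * (Λ * r) := by
      rw [mul_left_comm c, hcy]; ring
    have h4 := mul_lt_mul_of_pos_left hr hΛ0
    rw [h3] at h2
    nlinarith
  exact hxh.trans (le_of_mul_le_mul_left (a := c) (by linarith) hc0)

/-- The refit stays within the radius of strong convexity, and within the group lasso rate. -/
lemma sqrt_predSq_refit_le {d : Fin n → Fin (T + 1)} {pr : Fin n → Fin (T + 1) → ℝ}
    {γs : Coef T p} {X lam pmin b κ A : ℝ} {Shat : Finset (Fin p)} {γt γh : Coef T p}
    (hT : 1 ≤ T) (hX0 : 0 ≤ X) (hX : ∀ i j, |x i j| ≤ X) (hlam : 0 < X → 0 < lam)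
    (hpr : ∀ i t, pmin ≤ pr i t) (hpr1 : ∀ i, ∑ t, pr i t = 1) (hn : 0 < n)
    (hν : NoiseBound x d pr (2 * (groupSupport γs).card)
      (3 / 4 * lam * √(groupSupport γs).card / X))
    (hb : ∀ t : Fin T, propError x pr γs t.succ ≤ b)
    (hRE : IsRestrictedEigBound T (gram x) (groupSupport γs) κ)
    (hrate : RateConditions T (groupSupport γs).card (Shat ∪ groupSupport γs).card X lam pmin b κ
      (sparseEigMin (gram x) (Shat ∪ groupSupport γs)) A)
    (hlasso : IsGroupLasso x d lam γt) (hsupp : groupSupport γt ⊆ Shat)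
    (hcard : Shat.card ≤ (groupSupport γs).card) (hrefit : IsRefit x d Shat γh) :
    (∀ t, ∀ j, j ∉ Shat ∪ groupSupport γs → (γh - γs) t j = 0) ∧
    √(predSq x (γh - γs)) ≤ RM T (groupSupport γs).card lam pmin b κ A ∧
    ∀ i, ∑ t, index x (γh - γs) i t ^ 2 ≤ 1 / 16 := by
  have hκ := hrate.kappa_pos
  have hφ := hrate.phi_pos
  have hSDc : (Shat ∪ groupSupport γs).card ≤ 2 * (groupSupport γs).card :=
    (Finset.card_union_le _ _).trans (by linarith)
  have hs : 1 ≤ (groupSupport γs).card := by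
    have := (nonempty_of_sparseEigMin_pos hφ).card_pos
    omega
  have hκX : κ ≤ X := hRE.le_of_abs_le hT (Finset.card_pos.1 hs) hX0 hX
  have hXp : 0 < X := hκ.trans_le hκX
  have hlamp := hlam hXp
  have hb0 : 0 ≤ b := (Real.sqrt_nonneg _).trans (hb ⟨0, hT⟩)
  have hbp := hrate.b_lt
  have hpmin : 0 < pmin := hb0.trans_lt hbp
  obtain ⟨x0, hx0p, hx0R, hx0φ, hbc, hx0Λ⟩ := hrate.exists_level hT hs hXp hlamp hb0
  have hpmin1 : pmin ≤ 1 := by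
    have h1 := hpr ⟨0, hn⟩ 0
    rw [← hpr1 ⟨0, hn⟩]
    exact h1.trans (Finset.single_le_sum (fun t _ => hpmin.le.trans (hpr _ t))
      (Finset.mem_univ _))
  have hc0 : 0 < (pmin - b) ^ (T + 1) := pow_pos (by linarith) _
  -- The curvature really available is of order `pmin ^ 2`; it is lowered to match the factor `(A_p
  -- / pmin) ^ (T + 1)` in the rates, using `T + 1 ≥ 2`.
  have hc2 : (pmin - b) ^ (T + 1) ≤ pmin ^ 2 :=
    calc (pmin - b) ^ (T + 1) ≤ pmin ^ (T + 1) := pow_le_pow_left₀ (by linarith) (by linarith) _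
      _ ≤ pmin ^ 2 := pow_le_pow_of_le_one hpmin.le hpmin1 (by omega)
  have hB := fun (δ : Coef T p) hδ hq =>
    le_lossBregman (δ := δ) hX0 hX hpmin.le hpr hpr1 hb0 hb hφ hc0.le hc2 hx0φ hbc hδ hq
  have hℓ0 : 0 < lam * √(groupSupport γs).card / κ := by
    have : (0 : ℝ) < (groupSupport γs).card := by exact_mod_cast hs
    positivity
  have hνℓ : 3 / 4 * lam * √(groupSupport γs).card / X ≤
      3 / 4 * (lam * √(groupSupport γs).card / κ) := by
    rw [← mul_div_assoc, ← mul_assoc]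
    exact div_le_div_of_nonneg_left (by positivity) hκ hκX
  have hD : ∀ δ : Coef T p, (∀ t, ∀ j, j ∉ Shat ∪ groupSupport γs → δ t j = 0) →
      |lossDeriv x d γs δ| ≤
        (b * √T + 3 / 4 * (lam * √(groupSupport γs).card / κ)) * √(predSq x δ) := fun δ hδ =>
    (abs_lossDeriv_le hb0 hb hν hSDc hδ).trans
      (mul_le_mul_of_nonneg_right (by linarith) (Real.sqrt_nonneg _))
  have hsub : ∀ γ : Coef T p, groupSupport γ ⊆ Shat → ∀ t j, j ∉ Shat ∪ groupSupport γs →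
      (γ - γs) t j = 0 := fun γ hγ t j hj => by
    rw [Pi.sub_apply, Pi.sub_apply,
      eq_zero_of_groupSupport_subset (hγ.trans Finset.subset_union_left) t j hj,
      eq_zero_of_groupSupport_subset Finset.subset_union_right t j hj, sub_zero]
  have hδt0 := hsub γt hsupp
  have hδh0 := hsub γh hrefit.1
  have hBt := hlasso.lossBregman_le hlamp.le hκ hRE (hD _ hδt0)
  have hDt := (abs_le.1 (hD _ hδt0)).2
  have hDh := (abs_le.1 (hD _ hδh0)).1
  have hlt := loss_add x d γs (γt - γs)
  have hlh := loss_add x d γs (γh - γs)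
  rw [add_sub_cancel] at hlt hlh
  -- The lasso estimate is itself a competitor in the refit.
  have hr := hrefit.2 γt hsupp
  have hxt := Real.sqrt_nonneg (predSq x (γt - γs))
  have hxh := Real.sqrt_nonneg (predSq x (γh - γs))
  generalize hℓ : lam * √(groupSupport γs).card / κ = ℓ at *
  have hbT : 0 ≤ b * √T := by positivity
  have hxh0 : √(predSq x (γh - γs)) ≤ x0 := by
    refine sqrt_predSq_le_of_basic_inequalities hx0p hc0 (add_pos_of_pos_of_nonneg hℓ0 hbT)
      hx0Λ hB hδt0 hδh0 (hBt.trans (mul_le_mul_of_nonneg_right (by linarith) hxt)) ?_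
    have h1 : (b * √T + 3 / 4 * ℓ) * √(predSq x (γt - γs)) ≤
        (ℓ + b * √T) * √(predSq x (γt - γs)) :=
      mul_le_mul_of_nonneg_right (by linarith) hxt
    have h2 : (b * √T + 3 / 4 * ℓ) * √(predSq x (γh - γs)) ≤
        (ℓ + b * √T) * √(predSq x (γh - γs)) :=
      mul_le_mul_of_nonneg_right (by linarith) hxh
    linarith
  refine ⟨hδh0, hxh0.trans hx0R, fun i => ?_⟩
  refine (sum_sq_index_le hX hφ hδh0 i).trans ?_
  have h1 := (div_le_div_of_nonneg_right (mul_le_mul_of_nonneg_left hxh0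
    (by positivity : 0 ≤ X * √(Shat ∪ groupSupport γs).card)) hφ.le).trans hx0φ
  have h2 : 0 ≤ X * √(Shat ∪ groupSupport γs).card * √(predSq x (γh - γs)) /
    sparseEigMin (gram x) (Shat ∪ groupSupport γs) := by positivity
  calc _ ≤ (1 / 4 : ℝ) ^ 2 := pow_le_pow_left₀ h2 h1 2
    _ = _ := by norm_num

/-- Minkowski's inequality, with the logit being `1`-Lipschitz for small index changes. -/
lemma propError_add_le {pr : Fin n → Fin (T + 1) → ℝ} {γ δ : Coef T p}
    (hv : ∀ i, ∑ t, index x δ i t ^ 2 ≤ 1 / 16) (t : Fin (T + 1)) :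
    propError x pr (γ + δ) t ≤ √(predSq x δ) + propError x pr γ t := by
  have h1 := sqrt_empMean_add_sq_le
    (fun i => mlogit (index x (γ + δ) i) t - mlogit (index x γ i) t)
    (fun i => mlogit (index x γ i) t - pr i t)
  simp only [sub_add_sub_cancel] at h1
  have h2 : √(empMean fun i =>
      (mlogit (index x (γ + δ) i) t - mlogit (index x γ i) t) ^ 2) ≤ √(predSq x δ) := by
    refine Real.sqrt_le_sqrt (empMean_mono fun i => ?_)
    have h3 := abs_mlogit_add_sub_le (index x γ i) (index x δ i) (hv i) t
    rw [← index_add] at h3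
    rw [← sq_abs]
    calc _ ≤ √(∑ t, index x δ i t ^ 2) ^ 2 := pow_le_pow_left₀ (abs_nonneg _) h3 2
      _ = _ := Real.sq_sqrt (by positivity)
  exact h1.trans (add_le_add h2 le_rfl)

theorem refitBounds_of_noiseBound {d : Fin n → Fin (T + 1)} {pr : Fin n → Fin (T + 1) → ℝ}
    {γs : Coef T p} {X lam pmin b κ A : ℝ} {Shat : Finset (Fin p)} {γt γh : Coef T p}
    (hT : 1 ≤ T) (hX0 : 0 ≤ X) (hX : ∀ i j, |x i j| ≤ X) (hlam : 0 < X → 0 < lam)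
    (hpr : ∀ i t, pmin ≤ pr i t) (hpr1 : ∀ i, ∑ t, pr i t = 1) (hn : 0 < n)
    (hν : NoiseBound x d pr (2 * (groupSupport γs).card)
      (3 / 4 * lam * √(groupSupport γs).card / X)) :
    RefitBounds x d pr γs X lam pmin b κ A Shat γt γh := by
  intro hb hRE hrate hlasso hsupp hcard hrefit
  obtain ⟨h0, hR, hv⟩ := sqrt_predSq_refit_le hT hX0 hX hlam hpr hpr1 hn hν hb hRE hrate
    hlasso hsupp hcard hrefit
  have hR'' := hR.trans (le_max_left _ _ : _ ≤ RM'' T pmin b A _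
    (RM' T (Shat ∪ groupSupport γs).card lam pmin b
      (sparseEigMin (gram x) (Shat ∪ groupSupport γs)) A))
  refine ⟨fun t => ?_, fun t => ?_⟩
  · have h1 := propError_add_le (γ := γs) (pr := pr) hv t.succ
    rw [add_sub_cancel] at h1
    exact h1.trans (add_le_add hR'' (hb t))
  · refine (sum_abs_le hrate.phi_pos h0 t).trans ?_
    exact mul_le_mul_of_nonneg_left hR'' (div_nonneg (Real.sqrt_nonneg _) hrate.phi_pos.le)

end Bounds

/-! ### Exponential moments of sub-Gaussian vectors. -/

/-- Hoeffding's lemma for a finitely supported distribution. -/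
lemma sum_mul_exp_sub_mean_le {ι : Type*} [Fintype ι] {w V : ι → ℝ} (hw : ∀ t, 0 ≤ w t)
    (hw1 : ∑ t, w t = 1) {B : ℝ} (hB : ∀ s t, (V s - V t) ^ 2 ≤ B) :
    ∑ t, w t * Real.exp (V t - ∑ s, w s * V s) ≤ Real.exp (B / 8) := by
  classical
  let _ : MeasurableSpace ι := ⊤
  have hne : Nonempty ι := by
    by_contra h
    rw [not_nonempty_iff] at h
    simp at hw1
  set μ : Measure ι := ∑ t, ENNReal.ofReal (w t) • Measure.dirac t with hμ
  have hint : ∀ g : ι → ℝ, ∫ t, g t ∂μ = ∑ t, w t * g t := fun g => by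
    rw [hμ, integral_finsetSum_measure]
    · refine Finset.sum_congr rfl fun t _ => ?_
      rw [integral_smul_measure, integral_dirac, ENNReal.toReal_ofReal (hw t), smul_eq_mul]
    · intro t _
      exact (integrable_dirac (by simp)).smul_measure ENNReal.ofReal_ne_top
  have : IsProbabilityMeasure μ := ⟨by
    rw [hμ, Measure.coe_finsetSum, Finset.sum_apply]
    simp [← ENNReal.ofReal_sum_of_nonneg fun t _ => hw t, hw1]⟩
  obtain ⟨s0, hs0⟩ := Finite.exists_max V
  obtain ⟨t0, ht0⟩ := Finite.exists_min V
  have h := hasSubgaussianMGF_of_mem_Icc (μ := μ) (X := V) (a := V t0) (b := V s0)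
    (measurable_of_finite V).aemeasurable (Filter.Eventually.of_forall fun t => ⟨ht0 t, hs0 t⟩)
  have h1 := h.mgf_le 1
  rw [mgf, hint, hint] at h1
  simp only [one_mul] at h1
  refine h1.trans (Real.exp_le_exp.2 ?_)
  push_cast
  rw [Real.norm_eq_abs, div_pow, sq_abs]
  linarith [hB s0 t0]

lemma mlogit_noise_mgf_le {T : ℕ} {w : Fin (T + 1) → ℝ} (hw : ∀ t, 0 ≤ w t)
    (hw1 : ∑ t, w t = 1) (h : Fin T → ℝ) :
    ∑ r, w r * Real.exp (∑ t : Fin T, h t * ((if r = t.succ then 1 else 0) - w t.succ)) ≤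
      Real.exp ((∑ t, h t ^ 2) / 4) := by
  have h1 := sum_mul_exp_sub_mean_le hw hw1 (withBaseline_sub_sq_le h)
  rw [sum_mul_withBaseline] at h1
  refine le_trans (le_of_eq ?_) (h1.trans (Real.exp_le_exp.2 (by linarith)))
  refine Finset.sum_congr rfl fun r _ => ?_
  rw [withBaseline_apply, ← Finset.sum_sub_distrib]
  congr 2
  exact Finset.sum_congr rfl fun t _ => by ring

lemma integral_exp_sq_gaussianReal :
    ∫ g, Real.exp (g ^ 2 / 4) ∂(gaussianReal 0 1) = √2 := by
  rw [integral_gaussianReal_eq_integral_smul one_ne_zero]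
  have : ∀ g : ℝ, gaussianPDFReal 0 1 g • Real.exp (g ^ 2 / 4) =
      (√(2 * Real.pi))⁻¹ * Real.exp (-(1 / 4) * g ^ 2) := fun g => by
    rw [gaussianPDFReal, smul_eq_mul, mul_assoc, ← Real.exp_add]
    simp only [NNReal.coe_one, mul_one, sub_zero]
    congr 2; ring
  simp_rw [this]
  rw [integral_const_mul, integral_gaussian, inv_mul_eq_div, ← Real.sqrt_div (by positivity)]
  congr 1
  field_simp
  norm_num

lemma integrable_exp_sq_gaussianReal :
    Integrable (fun g => Real.exp (g ^ 2 / 4)) (gaussianReal 0 1) := by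
  by_contra h
  -- A nonintegrable function would have integral `0`, not `√2`.
  have h1 := integral_undef h
  rw [integral_exp_sq_gaussianReal] at h1
  exact (Real.sqrt_pos.2 (by norm_num : (0 : ℝ) < 2)).ne' h1

lemma integral_exp_mul_gaussianReal (y : ℝ) :
    ∫ g, Real.exp (y * g) ∂(gaussianReal 0 1) = Real.exp (y ^ 2 / 2) := by
  have := mgf_gaussianReal (p := gaussianReal 0 1) (X := id) (μ := 0) (v := 1)
    Measure.map_id y
  rw [mgf] at this
  simpa using this

/-- A finitely supported sub-Gaussian vector has an exponential moment of its squared norm. -/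
lemma sum_mul_exp_sq_le {D ι : Type*} [Fintype D] [Fintype ι] {W : D → ℝ}
    {Y : D → ι → ℝ}
    (hY : ∀ h : ι → ℝ, ∑ d, W d * Real.exp (∑ l, h l * Y d l) ≤ Real.exp ((∑ l, h l ^ 2) / 4)) :
    ∑ d, W d * Real.exp ((∑ l, Y d l ^ 2) / 2) ≤ √2 ^ Fintype.card ι := by
  classical
  -- The coordinates in `s` are squared one at a time, through `exp (y ^ 2 / 2) = 𝔼 exp (g y)` for a
  -- standard Gaussian `g`. The linear form `h` is kept general because each `g` becomes a new entry
  -- of it; integrating `exp (g ^ 2 / 4)` costs a factor `√2` per coordinate.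
  have key : ∀ (s : Finset ι) (h : ι → ℝ), (∀ l ∈ s, h l = 0) →
      ∑ d, W d * Real.exp (∑ l, h l * Y d l + (∑ l ∈ s, Y d l ^ 2) / 2) ≤
        Real.exp ((∑ l, h l ^ 2) / 4) * √2 ^ s.card := by
    intro s
    induction s using Finset.induction_on with
    | empty => intro h _; simpa using hY h
    | insert a s ha ih =>
      intro h hh
      have hha : h a = 0 := hh a (Finset.mem_insert_self a s)
      set c : D → ℝ := fun d => W d * Real.exp (∑ l, h l * Y d l + (∑ l ∈ s, Y d l ^ 2) / 2)
        with hc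
      have h1 : ∀ d, W d * Real.exp (∑ l, h l * Y d l + (∑ l ∈ insert a s, Y d l ^ 2) / 2) =
          ∫ g, c d * Real.exp (Y d a * g) ∂(gaussianReal 0 1) := fun d => by
        rw [integral_const_mul, integral_exp_mul_gaussianReal, hc, mul_assoc, ← Real.exp_add,
          Finset.sum_insert ha]
        congr 2; ring
      have hi : ∀ d, Integrable (fun g => c d * Real.exp (Y d a * g)) (gaussianReal 0 1) :=
        fun d => (integrable_exp_mul_gaussianReal (Y d a)).const_mul _
      simp_rw [h1]
      rw [← integral_finsetSum _ fun d _ => hi d]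
      have h2 : ∀ g : ℝ, ∑ d, c d * Real.exp (Y d a * g) ≤
          Real.exp ((∑ l, h l ^ 2) / 4) * √2 ^ s.card * Real.exp (g ^ 2 / 4) := fun g => by
        have h3 := ih (Function.update h a g) fun l hl => by
          rw [Function.update_of_ne (ne_of_mem_of_not_mem hl ha)]
          exact hh l (Finset.mem_insert_of_mem hl)
        have h4 : ∀ φ : ℝ → ι → ℝ, φ 0 a = 0 →
            ∑ l, φ (Function.update h a g l) l = ∑ l, φ (h l) l + φ g a := fun φ h0 => by
          rw [← Finset.add_sum_erase Finset.univ _ (Finset.mem_univ a),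
            ← Finset.add_sum_erase Finset.univ (fun l => φ (h l) l) (Finset.mem_univ a),
            Function.update_self, hha, h0, zero_add, add_comm]
          congr 1
          exact Finset.sum_congr rfl fun l hl => by
            rw [Function.update_of_ne (Finset.ne_of_mem_erase hl)]
        rw [h4 (fun u _ => u ^ 2) (by simp)] at h3
        have h5 : ∀ d, ∑ l, Function.update h a g l * Y d l = ∑ l, h l * Y d l + g * Y d a :=
          fun d => h4 (fun u l => u * Y d l) (by simp)
        simp_rw [h5] at h3
        refine le_trans (le_of_eq ?_) (h3.trans (le_of_eq ?_))
        · refine Finset.sum_congr rfl fun d _ => ?_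
          rw [hc, mul_assoc, ← Real.exp_add]
          congr 2; ring
        · rw [add_div, Real.exp_add]; ring
      refine (integral_mono (integrable_finsetSum _ fun d _ => hi d)
        (integrable_exp_sq_gaussianReal.const_mul _) h2).trans (le_of_eq ?_)
      rw [integral_const_mul, integral_exp_sq_gaussianReal, Finset.card_insert_of_notMem ha,
        pow_succ]
      ring
  simpa using key Finset.univ 0 (by simp)

/-- Orthonormal coordinates for the column span of a matrix with `k` columns. -/
lemma exists_orthonormal_coords {n k : ℕ} (x : Fin n → Fin k → ℝ) :
    ∃ K ≤ k, ∃ (e : Fin K → Fin n → ℝ) (a : Fin k → Fin K → ℝ),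
      (∀ l m, ∑ i, e l i * e m i = if l = m then 1 else 0) ∧
      ∀ i j, x i j = ∑ l, a j l * e l i := by
  set col : Fin k → EuclideanSpace ℝ (Fin n) := fun j => WithLp.toLp 2 fun i => x i j with hcol
  set V := Submodule.span ℝ (Set.range col) with hV
  set B := stdOrthonormalBasis ℝ V with hB
  refine ⟨Module.finrank ℝ V, (finrank_range_le_card col).trans (by simp),
    fun l i => (B l : EuclideanSpace ℝ (Fin n)) i,
    fun j l => inner ℝ (B l) ⟨col j, Submodule.subset_span ⟨j, rfl⟩⟩, fun l m => ?_,
    fun i j => ?_⟩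
  · have := orthonormal_iff_ite.1 B.orthonormal l m
    rw [← this, Submodule.coe_inner, PiLp.inner_apply]
    exact Finset.sum_congr rfl fun i _ => by simp [mul_comm]
  · have h := B.sum_repr' ⟨col j, Submodule.subset_span ⟨j, rfl⟩⟩
    have h1 := congrArg (fun v : V => (v : EuclideanSpace ℝ (Fin n)) i) h
    simp only [hcol, Submodule.coe_sum, Submodule.coe_smul] at h1
    simpa using h1.symm

/-! ### The self-normalized noise bound, conditionally on the covariates. -/

section Noise

variable {n k T : ℕ}

/-- The empirical inner product of the noise with the direction `δ`. -/
noncomputable def noiseInner (x : Fin n → Fin k → ℝ) (d : Fin n → Fin (T + 1))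
    (pr : Fin n → Fin (T + 1) → ℝ) (δ : Coef T k) : ℝ :=
  empMean fun i => ∑ t : Fin T, ((if d i = t.succ then 1 else 0) - pr i t.succ) * index x δ i t

open Classical in
/-- Conditionally on the covariates, the noise violates the self-normalized bound with small
probability. -/
lemma sum_weight_not_noise_le (hn : 0 < n) (x : Fin n → Fin k → ℝ)
    {pr : Fin n → Fin (T + 1) → ℝ} (hpr : ∀ i t, 0 ≤ pr i t) (hpr1 : ∀ i, ∑ t, pr i t = 1)
    {ν : ℝ} (hν : 0 ≤ ν) :
    (∑ d : Fin n → Fin (T + 1), (∏ i, pr i (d i)) *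
      if ∃ δ : Coef T k, ν * √(predSq x δ) < |noiseInner x d pr δ| then 1 else 0) ≤
      √2 ^ (T * k) * Real.exp (-(n * ν ^ 2) / 2) := by
  obtain ⟨K, hK, e, a, he, ha⟩ := exists_orthonormal_coords x
  have hn0 : (0 : ℝ) < n := by exact_mod_cast hn
  -- Coordinates of the noise in an orthonormal basis of the column span. Self-normalization is
  -- exact in this basis: no eigenvalue of the design enters.
  set Y : (Fin n → Fin (T + 1)) → Fin T × Fin K → ℝ := fun d q =>
    ∑ i, ((if d i = q.1.succ then 1 else 0) - pr i q.1.succ) * e q.2 i with hY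
  set W : (Fin n → Fin (T + 1)) → ℝ := fun d => ∏ i, pr i (d i) with hWd
  have hW : ∀ d, 0 ≤ W d := fun d => Finset.prod_nonneg fun i _ => hpr _ _
  have hnorm : ∀ c : Fin K → ℝ, ∑ i, (∑ l, c l * e l i) ^ 2 = ∑ l, c l ^ 2 := fun c => by
    have h1 : ∀ i, (∑ l, c l * e l i) ^ 2 = ∑ l, ∑ m, c l * c m * (e l i * e m i) := fun i => by
      rw [sq, Finset.sum_mul_sum]
      exact Finset.sum_congr rfl fun l _ => Finset.sum_congr rfl fun m _ => by ring
    simp_rw [h1]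
    rw [Finset.sum_comm]
    refine Finset.sum_congr rfl fun l _ => ?_
    rw [Finset.sum_comm]
    simp_rw [← Finset.mul_sum, he]
    simp [sq]
  have hmgf : ∀ h : Fin T × Fin K → ℝ, ∑ d, W d * Real.exp (∑ q, h q * Y d q) ≤
      Real.exp ((∑ q, h q ^ 2) / 4) := fun h => by
    have h1 : ∀ d, W d * Real.exp (∑ q, h q * Y d q) = ∏ i, (pr i (d i) *
        Real.exp (∑ t : Fin T, (∑ l, h (t, l) * e l i) *
          ((if d i = t.succ then 1 else 0) - pr i t.succ))) := fun d => by
      rw [Finset.prod_mul_distrib, ← Real.exp_sum]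
      congr 2
      simp_rw [hY, Fintype.sum_prod_type, Finset.mul_sum, Finset.sum_mul]
      rw [eq_comm, Finset.sum_comm]
      refine Finset.sum_congr rfl fun t _ => ?_
      rw [Finset.sum_comm]
      exact Finset.sum_congr rfl fun l _ => Finset.sum_congr rfl fun i _ => by ring
    simp_rw [h1]
    rw [← Fintype.piFinset_univ, ← Finset.prod_univ_sum (fun _ => Finset.univ) (fun i r =>
      pr i r * Real.exp (∑ t : Fin T, (∑ l, h (t, l) * e l i) *
          ((if r = t.succ then 1 else 0) - pr i t.succ)))]
    refine (Finset.prod_le_prod (fun i _ => Finset.sum_nonneg fun r _ =>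
      mul_nonneg (hpr _ _) (Real.exp_pos _).le)
      fun i _ => mlogit_noise_mgf_le (hpr i) (hpr1 i) _).trans (le_of_eq ?_)
    rw [← Real.exp_sum, ← Finset.sum_div, Finset.sum_comm, Fintype.sum_prod_type]
    simp_rw [hnorm]
  have hchi := sum_mul_exp_sq_le hmgf
  -- By Cauchy–Schwarz a violation in any direction forces the projected noise to be long, so the
  -- supremum over directions costs no further union bound.
  have hbad : ∀ d, (∃ δ : Coef T k, ν * √(predSq x δ) < |noiseInner x d pr δ|) →
      n * ν ^ 2 ≤ ∑ q, Y d q ^ 2 := by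
    rintro d ⟨δ, hδ⟩
    set c : Fin T × Fin K → ℝ := fun q => ∑ j, δ q.1 j * a j q.2 with hc
    have hidx : ∀ i t, index x δ i t = ∑ l, c (t, l) * e l i := fun i t => by
      simp_rw [index, ha, hc, Finset.sum_mul]
      rw [Finset.sum_comm]
      exact Finset.sum_congr rfl fun j _ => Finset.sum_congr rfl fun l _ => by ring
    have hpred : predSq x δ = (∑ q, c q ^ 2) / n := by
      rw [predSq, empMean, Finset.sum_comm, Fintype.sum_prod_type]
      simp_rw [hidx, hnorm]
    have hinner : noiseInner x d pr δ = (∑ q, c q * Y d q) / n := by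
      rw [noiseInner, empMean, Finset.sum_comm, Fintype.sum_prod_type]
      congr 1
      refine Finset.sum_congr rfl fun t _ => ?_
      simp_rw [hidx, hY, Finset.mul_sum]
      rw [Finset.sum_comm]
      exact Finset.sum_congr rfl fun l _ => Finset.sum_congr rfl fun i _ => by ring
    rw [hpred, hinner, abs_div, Nat.abs_cast] at hδ
    have hsq := pow_lt_pow_left₀ hδ (by positivity) two_ne_zero
    rw [mul_pow, Real.sq_sqrt (by positivity), div_pow, sq_abs] at hsq
    have hcs := Finset.sum_mul_sq_le_sq_mul_sq Finset.univ c (Y d)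
    rw [lt_div_iff₀ (by positivity)] at hsq
    have h3 : ν ^ 2 * ((∑ q, c q ^ 2) / n) * (n : ℝ) ^ 2 = (∑ q, c q ^ 2) * (n * ν ^ 2) := by
      field_simp
    rw [h3] at hsq
    have h4 := hsq.trans_le hcs
    exact (lt_of_mul_lt_mul_left h4 (by positivity)).le
  -- Markov's inequality in exponential form.
  have hstep : ∀ d, W d * (if ∃ δ : Coef T k, ν * √(predSq x δ) < |noiseInner x d pr δ|
      then (1 : ℝ) else 0) ≤
      Real.exp (-(n * ν ^ 2) / 2) * (W d * Real.exp ((∑ q, Y d q ^ 2) / 2)) := fun d => by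
    rw [mul_left_comm, ← Real.exp_add]
    refine mul_le_mul_of_nonneg_left ?_ (hW d)
    split_ifs with h
    · refine Real.one_le_exp ?_
      linarith [hbad d h]
    · exact (Real.exp_pos _).le
  refine (Finset.sum_le_sum fun d _ => hstep d).trans ?_
  rw [← Finset.mul_sum, mul_comm]
  refine mul_le_mul_of_nonneg_right (hchi.trans ?_) (Real.exp_pos _).le
  simp only [Fintype.card_prod, Fintype.card_fin]
  exact pow_le_pow_right₀ (Real.one_le_sqrt.2 (by norm_num)) (Nat.mul_le_mul_left T hK)

/-- The self-normalized bound over all small sets of covariates follows from the bounds for the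
designs with `k` columns. -/
lemma noiseBound_of_forall {p : ℕ} {x : Fin n → Fin p → ℝ} {d : Fin n → Fin (T + 1)}
    {pr : Fin n → Fin (T + 1) → ℝ} {ν : ℝ}
    (h : ∀ (f : Fin k → Fin p) (δ : Coef T k),
      |noiseInner (fun i l => x i (f l)) d pr δ| ≤ ν * √(predSq (fun i l => x i (f l)) δ)) :
    NoiseBound x d pr k ν := by
  classical
  intro S hS δ hδ
  rcases S.eq_empty_or_nonempty with h0 | ⟨j0, hj0⟩
  · have h1 : δ = 0 := by ext t j; exact hδ t j (by simp [h0])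
    subst h1
    simp [index, predSq, empMean]
  obtain ⟨g⟩ : Nonempty (S ↪ Fin k) := Function.Embedding.nonempty_of_card_le (by simpa using hS)
  -- Columns beyond those of `S` are padded with `j0`. Repetitions are harmless, so one may count
  -- all `p ^ k` maps instead of subsets of each size.
  set f : Fin k → Fin p := Function.extend g Subtype.val fun _ => j0 with hf
  have hfg : ∀ j : S, f (g j) = j := fun j => g.injective.extend_apply _ _ j
  set δ' : Coef T k := fun t l => ∑ j : S, if g j = l then δ t j else 0 with hδ'
  have hidx : index (fun i l => x i (f l)) δ' = index x δ := by
    ext i t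
    simp only [index, hδ', Finset.mul_sum]
    rw [Finset.sum_comm]
    have h1 : ∀ j : S, ∑ l, x i (f l) * (if g j = l then δ t j else 0) = x i j * δ t j :=
      fun j => by simp [hfg]
    simp_rw [h1]
    rw [Finset.sum_coe_sort S (fun j => x i j * δ t j)]
    refine Finset.sum_subset (Finset.subset_univ S) fun j _ hj => ?_
    rw [hδ t j hj, mul_zero]
  have h1 := h f δ'
  simp only [noiseInner, predSq, hidx] at h1
  exact h1

end Noise

/-! ### Disintegration of the sample law through the propensity scores. -/

section Propensity

variable {E : Type*} [MeasurableSpace E] {T : ℕ} {P : Measure (E × Fin (T + 1))}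
  [IsProbabilityMeasure P] {pr : Fin (T + 1) → E → ℝ}

lemma measurableSet_treatment (t : Fin (T + 1)) :
    MeasurableSet {z : E × Fin (T + 1) | z.2 = t} :=
  measurable_snd (measurableSet_singleton t)

lemma integrable_treatment (t : Fin (T + 1)) :
    Integrable (Set.indicator {z : E × Fin (T + 1) | z.2 = t} fun _ => (1 : ℝ)) P :=
  (integrable_const 1).indicator (measurableSet_treatment t)

lemma IsPropensityScore.sum_eq_one (h : IsPropensityScore P pr) :
    ∀ᵐ z ∂P, ∑ t, pr t z.1 = 1 := by
  have h1 := condExp_finsetSum (s := Finset.univ) (μ := P)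
    (fun (t : Fin (T + 1)) _ => integrable_treatment (E := E) t)
    (MeasurableSpace.comap Prod.fst inferInstance)
  have h2 : ∑ t : Fin (T + 1),
      Set.indicator {z : E × Fin (T + 1) | z.2 = t} (fun _ => (1 : ℝ)) = fun _ => 1 := by
    ext z
    rw [Finset.sum_apply, Finset.sum_eq_single z.2]
    · simp
    · intro t _ ht
      exact Set.indicator_of_notMem (fun hz => ht hz.symm) _
    · simp
  rw [h2, condExp_const measurable_fst.comap_le] at h1
  have h3 : ∀ᵐ z ∂P, ∀ t, (P[Set.indicator {z : E × Fin (T + 1) | z.2 = t}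
      (fun _ => (1 : ℝ)) | MeasurableSpace.comap Prod.fst inferInstance]) z = pr t z.1 :=
    ae_all_iff.2 fun t => (h t).2
  filter_upwards [h1, h3] with z hz1 hz3
  rw [Finset.sum_apply] at hz1
  simp_rw [hz3] at hz1
  exact hz1.symm

lemma IsPropensityScore.measure_inter (h : IsPropensityScore P pr)
    (h0 : ∀ᵐ z ∂P, ∀ t, 0 ≤ pr t z.1) (t : Fin (T + 1)) {s : Set E} (hs : MeasurableSet s) :
    P (Prod.fst ⁻¹' s ∩ {z | z.2 = t}) = ∫⁻ z in Prod.fst ⁻¹' s, ENNReal.ofReal (pr t z.1) ∂P := by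
  have hm : MeasurableSpace.comap (Prod.fst : E × Fin (T + 1) → E) inferInstance ≤
      Prod.instMeasurableSpace := measurable_fst.comap_le
  have hsm : MeasurableSet (Prod.fst ⁻¹' s : Set (E × Fin (T + 1))) := measurable_fst hs
  have h1 := setIntegral_condExp (μ := P) (s := Prod.fst ⁻¹' s) hm
    (integrable_treatment (E := E) t) ⟨s, hs, rfl⟩
  rw [setIntegral_congr_ae hsm ((h t).2.mono fun z hz _ => hz),
    setIntegral_indicator (measurableSet_treatment t), setIntegral_const, smul_eq_mul,
    mul_one] at h1
  have hint : Integrable (fun z : E × Fin (T + 1) => pr t z.1) P :=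
    integrable_condExp.congr (h t).2
  rw [← ofReal_integral_eq_lintegral_ofReal hint.integrableOn
    (ae_restrict_of_ae (h0.mono fun z hz => hz t)), h1, measureReal_def,
    ENNReal.ofReal_toReal (measure_ne_top _ _)]

/-- Slice the event by treatment: each slice is a cylinder over the covariates, where the defining
property of conditional expectation applies. No regular conditional law is needed, as there are
finitely many treatments. -/
lemma IsPropensityScore.measure_eq (h : IsPropensityScore P pr)
    (h0 : ∀ᵐ z ∂P, ∀ t, 0 ≤ pr t z.1) {s : Set (E × Fin (T + 1))} (hs : MeasurableSet s) :
    P s = ∑ t, ∫⁻ z, ENNReal.ofReal (pr t z.1) * s.indicator 1 (z.1, t) ∂P := by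
  have hst : ∀ t : Fin (T + 1), MeasurableSet {x : E | (x, t) ∈ s} := fun t =>
    measurable_prodMk_right hs
  have h1 : s = ⋃ t : Fin (T + 1), Prod.fst ⁻¹' {x : E | (x, t) ∈ s} ∩ {z | z.2 = t} := by
    ext ⟨x, r⟩
    simp
  conv_lhs => rw [h1]
  rw [measure_iUnion, tsum_fintype]
  · refine Finset.sum_congr rfl fun t _ => ?_
    rw [h.measure_inter h0 t (hst t), ← lintegral_indicator (measurable_fst (hst t))]
    refine lintegral_congr fun z => ?_
    by_cases hz : (z.1, t) ∈ s
    · simp [hz]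
    · simp [hz]
  · intro t r htr
    refine Set.disjoint_left.2 fun z hz hz' => htr ?_
    exact hz.2.symm.trans hz'.2
  · exact fun t => (measurable_fst (hst t)).inter (measurableSet_treatment t)

/-- Given the covariates, the treatments are independent with the propensity scores as their
probabilities. -/
lemma IsPropensityScore.pi_apply {n : ℕ} (h : IsPropensityScore P pr)
    (h0 : ∀ᵐ z ∂P, ∀ t, 0 ≤ pr t z.1) {B : Set (Fin n → E × Fin (T + 1))}
    (hB : MeasurableSet B) :
    Measure.pi (fun _ : Fin n => P) B = ∑ d : Fin n → Fin (T + 1),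
      ∫⁻ z, (∏ i, ENNReal.ofReal (pr (d i) (z i).1)) * B.indicator 1 (fun i => ((z i).1, d i))
        ∂Measure.pi fun _ : Fin n => P := by
  set Φ : (Fin n → Fin (T + 1)) → (Fin n → E × Fin (T + 1)) → Fin n → E × Fin (T + 1) :=
    fun d z i => ((z i).1, d i) with hΦ
  have hΦm : ∀ d, Measurable (Φ d) := fun d => measurable_pi_lambda _ fun i =>
    (measurable_fst.comp (measurable_pi_apply i)).prodMk measurable_const
  set M : Measure (Fin n → E × Fin (T + 1)) := ∑ d : Fin n → Fin (T + 1),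
    ((Measure.pi fun _ : Fin n => P).withDensity
      fun z => ∏ i, ENNReal.ofReal (pr (d i) (z i).1)).map (Φ d) with hM
  have hMB : ∀ C : Set (Fin n → E × Fin (T + 1)), MeasurableSet C →
      M C = ∑ d : Fin n → Fin (T + 1),
        ∫⁻ z, (∏ i, ENNReal.ofReal (pr (d i) (z i).1)) * C.indicator 1 (Φ d z)
          ∂Measure.pi fun _ : Fin n => P := fun C hC => by
    rw [hM, Measure.coe_finsetSum, Finset.sum_apply]
    refine Finset.sum_congr rfl fun d _ => ?_
    rw [Measure.map_apply (hΦm d) hC, withDensity_apply _ (hΦm d hC),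
      ← lintegral_indicator (hΦm d hC)]
    refine lintegral_congr fun z => ?_
    by_cases hz : Φ d z ∈ C
    · rw [Set.indicator_of_mem (show z ∈ Φ d ⁻¹' C from hz), Set.indicator_of_mem hz]; simp
    · rw [Set.indicator_of_notMem (show z ∉ Φ d ⁻¹' C from hz), Set.indicator_of_notMem hz]; simp
  rw [← hMB B hB]
  congr 1
  -- Both sides are measures in `B`, so boxes suffice; there the integrals factor over observations
  -- and the sum over `d` becomes a product of sums.
  refine Measure.pi_eq fun s hs => ?_
  rw [hMB _ (MeasurableSet.univ_pi hs)]
  have h1 : ∀ d : Fin n → Fin (T + 1),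
      ∫⁻ z, (∏ i, ENNReal.ofReal (pr (d i) (z i).1)) * (Set.univ.pi s).indicator 1 (Φ d z)
        ∂Measure.pi (fun _ : Fin n => P) =
      ∏ i, ∫⁻ z, ENNReal.ofReal (pr (d i) z.1) * (s i).indicator 1 (z.1, d i) ∂P := fun d => by
    set g : Fin n → E × Fin (T + 1) → ENNReal := fun i z =>
      ENNReal.ofReal (pr (d i) z.1) * (s i).indicator 1 (z.1, d i) with hg
    have hgm : ∀ i, Measurable (g i) := fun i =>
      ((h (d i)).1.comp measurable_fst).ennreal_ofReal.mul
        ((measurable_one.indicator (hs i)).comp (measurable_fst.prodMk measurable_const))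
    have h2 : ∀ z, (∏ i, ENNReal.ofReal (pr (d i) (z i).1)) *
        (Set.univ.pi s).indicator 1 (Φ d z) = ∏ i, g i (z i) := fun z => by
      rw [hg, Finset.prod_mul_distrib]
      congr 1
      by_cases hz : Φ d z ∈ Set.univ.pi s
      · rw [Set.indicator_of_mem hz]
        refine (Finset.prod_eq_one fun i _ => ?_).symm
        exact Set.indicator_of_mem (hz i (Set.mem_univ i)) _
      · rw [Set.indicator_of_notMem hz]
        obtain ⟨i, hi⟩ : ∃ i, Φ d z i ∉ s i := by
          by_contra! hcon
          exact hz fun i _ => hcon i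
        exact (Finset.prod_eq_zero (Finset.mem_univ i) (Set.indicator_of_notMem hi _)).symm
    simp_rw [h2]
    refine (lintegral_prod_eq_prod_lintegral_of_indepFun Finset.univ
      (fun i (z : Fin n → E × Fin (T + 1)) => g i (z i))
      (iIndepFun_pi (X := g) fun i => (hgm i).aemeasurable)
      fun i => (hgm i).comp (measurable_pi_apply i)).trans ?_
    refine Finset.prod_congr rfl fun i _ => ?_
    exact (measurePreserving_eval (fun _ : Fin n => P) i).lintegral_comp (hgm i)
  simp_rw [h1]
  rw [← Fintype.piFinset_univ, ← Finset.prod_univ_sum (fun _ => Finset.univ) (fun i t =>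
    ∫⁻ z, ENNReal.ofReal (pr t z.1) * (s i).indicator 1 (z.1, t) ∂P)]
  exact Finset.prod_congr rfl fun i _ => (h.measure_eq h0 (hs i)).symm

end Propensity

/-! ### Measurability and unconditional probability of the noise event. -/

section Continuity

variable {n k T : ℕ}

lemma continuous_index (x : Fin n → Fin k → ℝ) (i : Fin n) (t : Fin T) :
    Continuous fun δ : Coef T k => index x δ i t := by
  unfold index; fun_prop

lemma continuous_predSq (x : Fin n → Fin k → ℝ) :
    Continuous fun δ : Coef T k => predSq x δ := by
  unfold predSq empMean
  exact (continuous_finsetSum _ fun i _ => continuous_finsetSum _ fun t _ =>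
    (continuous_index x i t).pow 2).div_const _

lemma continuous_noiseInner (x : Fin n → Fin k → ℝ) (d : Fin n → Fin (T + 1))
    (pr : Fin n → Fin (T + 1) → ℝ) : Continuous fun δ : Coef T k => noiseInner x d pr δ := by
  unfold noiseInner empMean
  exact (continuous_finsetSum _ fun i _ => continuous_finsetSum _ fun t _ =>
    (continuous_index x i t).const_mul _).div_const _

/-- The violating directions form an open set, so a rational one suffices; the event becomes a
countable union, hence measurable. -/
lemma exists_rat_of_exists (x : Fin n → Fin k → ℝ) (d : Fin n → Fin (T + 1))
    (pr : Fin n → Fin (T + 1) → ℝ) (ν : ℝ) :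
    (∃ δ : Coef T k, ν * √(predSq x δ) < |noiseInner x d pr δ|) ↔
      ∃ q : Fin T → Fin k → ℚ, ν * √(predSq x fun t l => (q t l : ℝ)) <
        |noiseInner x d pr fun t l => (q t l : ℝ)| := by
  refine ⟨fun h => ?_, fun ⟨q, hq⟩ => ⟨_, hq⟩⟩
  have hd : DenseRange (Pi.map fun _ : Fin T => Pi.map fun _ : Fin k => ((↑) : ℚ → ℝ)) :=
    DenseRange.piMap fun _ => DenseRange.piMap fun _ => Rat.denseRange_cast
  have ho : IsOpen {δ : Coef T k | ν * √(predSq x δ) < |noiseInner x d pr δ|} :=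
    isOpen_lt ((continuous_predSq x).sqrt.const_mul ν) (continuous_noiseInner x d pr).abs
  obtain ⟨q, hq⟩ := hd.exists_mem_open ho h
  exact ⟨q, hq⟩

variable {E : Type*} [MeasurableSpace E]

lemma measurable_index {x : E → Fin k → ℝ} (hx : Measurable x) (δ : Coef T k) (i : Fin n)
    (t : Fin T) : Measurable fun z : Fin n → E × Fin (T + 1) =>
      index (fun i => x (z i).1) δ i t := by
  unfold index
  refine Finset.measurable_sum _ fun j _ => Measurable.mul_const ?_ _
  exact (measurable_pi_apply j).comp (hx.comp (measurable_fst.comp (measurable_pi_apply i)))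

lemma measurableSet_not_noise {x : E → Fin k → ℝ} (hx : Measurable x)
    {pr : Fin (T + 1) → E → ℝ} (hpr : ∀ t, Measurable (pr t)) (ν : ℝ) :
    MeasurableSet {z : Fin n → E × Fin (T + 1) | ∃ δ : Coef T k,
      ν * √(predSq (fun i => x (z i).1) δ) <
        |noiseInner (fun i => x (z i).1) (fun i => (z i).2) (fun i t => pr t (z i).1) δ|} := by
  simp_rw [exists_rat_of_exists]
  rw [Set.ofPred_exists]
  refine MeasurableSet.iUnion fun q => measurableSet_lt ?_ ?_
  · refine Measurable.const_mul (Measurable.sqrt ?_) _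
    unfold predSq empMean
    exact (Finset.measurable_sum _ fun i _ => Finset.measurable_sum _ fun t _ =>
      (measurable_index hx _ i t).pow_const 2).div_const _
  · refine Measurable.abs ?_
    unfold noiseInner empMean
    refine (Finset.measurable_sum _ fun i _ => Finset.measurable_sum _ fun t _ =>
      Measurable.mul (Measurable.sub ?_ ?_) (measurable_index hx _ i t)).div_const _
    · exact (measurable_of_finite fun r : Fin (T + 1) => if r = t.succ then (1 : ℝ) else 0).comp
        (measurable_snd.comp (measurable_pi_apply i))
    · exact (hpr t.succ).comp (measurable_fst.comp (measurable_pi_apply i))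

/-- Unconditional probability that the noise violates the self-normalized bound. -/
lemma measure_not_noise_le (hn : 0 < n) {P : Measure (E × Fin (T + 1))} [IsProbabilityMeasure P]
    {x : E → Fin k → ℝ} (hx : Measurable x) {pr : Fin (T + 1) → E → ℝ}
    (hpr : IsPropensityScore P pr) (h0 : ∀ᵐ z ∂P, ∀ t, 0 ≤ pr t z.1) {ν : ℝ} (hν : 0 ≤ ν) :
    Measure.pi (fun _ : Fin n => P) {z | ∃ δ : Coef T k,
      ν * √(predSq (fun i => x (z i).1) δ) <
        |noiseInner (fun i => x (z i).1) (fun i => (z i).2) (fun i t => pr t (z i).1) δ|} ≤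
      ENNReal.ofReal (√2 ^ (T * k) * Real.exp (-(n * ν ^ 2) / 2)) := by
  classical
  have hB := measurableSet_not_noise (n := n) hx (fun t => (hpr t).1) ν
  set B := {z : Fin n → E × Fin (T + 1) | ∃ δ : Coef T k,
      ν * √(predSq (fun i => x (z i).1) δ) <
        |noiseInner (fun i => x (z i).1) (fun i => (z i).2) (fun i t => pr t (z i).1) δ|} with hBd
  have hΦm : ∀ d : Fin n → Fin (T + 1), Measurable fun (z : Fin n → E × Fin (T + 1)) (i : Fin n) =>
      ((z i).1, d i) := fun d => measurable_pi_lambda _ fun i =>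
    (measurable_fst.comp (measurable_pi_apply i)).prodMk measurable_const
  rw [hpr.pi_apply h0 hB, ← lintegral_finsetSum]
  swap
  · intro d _
    refine Measurable.mul (Finset.measurable_prod _ fun i _ => ((hpr (d i)).1.comp
      (measurable_fst.comp (measurable_pi_apply i))).ennreal_ofReal) ?_
    exact (measurable_one.indicator hB).comp (hΦm d)
  have hae : ∀ᵐ z ∂Measure.pi (fun _ : Fin n => P), ∀ i,
      (∀ t, 0 ≤ pr t (z i).1) ∧ ∑ t, pr t (z i).1 = 1 :=
    ae_all_iff.2 fun i => (measurePreserving_eval (fun _ : Fin n => P) i).quasiMeasurePreserving.ae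
      (h0.and hpr.sum_eq_one)
  refine (lintegral_mono_ae (g := fun _ => ENNReal.ofReal
    (√2 ^ (T * k) * Real.exp (-(n * ν ^ 2) / 2))) (hae.mono fun z hz => ?_)).trans (by simp)
  have h1 := sum_weight_not_noise_le hn (fun i => x (z i).1) (pr := fun i t => pr t (z i).1)
    (fun i => (hz i).1) (fun i => (hz i).2) hν
  refine le_trans (le_of_eq ?_) (ENNReal.ofReal_le_ofReal h1)
  rw [ENNReal.ofReal_sum_of_nonneg fun d _ => mul_nonneg
    (Finset.prod_nonneg fun i _ => (hz i).1 _) (by split_ifs <;> norm_num)]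
  refine Finset.sum_congr rfl fun d _ => ?_
  rw [ENNReal.ofReal_mul (Finset.prod_nonneg fun i _ => (hz i).1 _),
    ENNReal.ofReal_prod_of_nonneg fun i _ => (hz i).1 _, Set.indicator_apply]
  congr 1
  simp only [hBd, Set.mem_ofPred_eq, Pi.one_apply]
  split_ifs <;> simp

end Continuity

/-! ### Calibration of the penalty and of the exceptional probability. -/

lemma penalty_sq {n p T : ℕ} (hn : 0 < n) (hT : 1 ≤ T) (X δD : ℝ) :
    n * penalty n p T X δD ^ 2 =
      4 * X ^ 2 * (T + √T * Real.log (max p n : ℕ) ^ (3 / 2 + δD)) := by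
  have hn0 : (0 : ℝ) < n := by exact_mod_cast hn
  have hT0 : (0 : ℝ) < T := by exact_mod_cast hT
  have hr : 0 ≤ Real.log (max p n : ℕ) ^ (3 / 2 + δD) :=
    Real.rpow_nonneg (Real.log_natCast_nonneg _) _
  unfold penalty
  set r := Real.log (max p n : ℕ) ^ (3 / 2 + δD)
  rw [mul_pow, div_pow, mul_pow, Real.sq_sqrt hn0.le, Real.sq_sqrt hT0.le,
    Real.sq_sqrt (by positivity)]
  have h1 : (T : ℝ) * (1 + r / √T) = T + √T * r := by
    rw [mul_add, mul_one, mul_div_left_comm, Real.div_sqrt, mul_comm r]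
  rw [← h1]
  field_simp
  ring

lemma penalty_pos {n p T : ℕ} (hn : 0 < n) (hT : 1 ≤ T) {X : ℝ} (hX : 0 < X) (δD : ℝ) :
    0 < penalty n p T X δD := by
  have hn0 : (0 : ℝ) < n := by exact_mod_cast hn
  have hT0 : (0 : ℝ) < T := by exact_mod_cast hT
  have hr : 0 ≤ Real.log (max p n : ℕ) ^ (3 / 2 + δD) :=
    Real.rpow_nonneg (Real.log_natCast_nonneg _) _
  unfold penalty
  positivity

/-- Tail bound for one design with `2 * s` columns, at the noise level used for the penalty. -/
lemma noise_tail_le {n p T s : ℕ} (hn : 0 < n) (hT : 1 ≤ T) {X : ℝ} (hX : 0 < X) (δD : ℝ) :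
    √2 ^ (T * (2 * s)) *
        Real.exp (-(n * (3 / 4 * penalty n p T X δD * √s / X) ^ 2) / 2) ≤
      Real.exp (-(s * Real.log (max p n : ℕ) ^ (3 / 2 + δD))) := by
  have hr : 0 ≤ Real.log (max p n : ℕ) ^ (3 / 2 + δD) :=
    Real.rpow_nonneg (Real.log_natCast_nonneg _) _
  have h1 : n * (3 / 4 * penalty n p T X δD * √s / X) ^ 2 =
      9 / 4 * s * (T + √T * Real.log (max p n : ℕ) ^ (3 / 2 + δD)) := by
    have h2 : n * (3 / 4 * penalty n p T X δD * √s / X) ^ 2 =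
        9 / 16 * s * (n * penalty n p T X δD ^ 2) / X ^ 2 := by
      rw [div_pow, mul_pow, mul_pow, Real.sq_sqrt (Nat.cast_nonneg s)]
      ring
    rw [h2, penalty_sq hn hT]
    field_simp
    ring
  set r := Real.log (max p n : ℕ) ^ (3 / 2 + δD)
  have hT1 : (1 : ℝ) ≤ T := by exact_mod_cast hT
  have hs0 : (0 : ℝ) ≤ s := Nat.cast_nonneg s
  have h3 : √2 ^ (T * (2 * s)) ≤ Real.exp (T * s) := by
    have : √(2 : ℝ) ^ (T * (2 * s)) = 2 ^ (T * s) := by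
      rw [show T * (2 * s) = 2 * (T * s) by ring, pow_mul, Real.sq_sqrt (by norm_num)]
    rw [this]
    calc (2 : ℝ) ^ (T * s) ≤ Real.exp 1 ^ (T * s) :=
          pow_le_pow_left₀ (by norm_num) (by linarith [Real.add_one_le_exp (1 : ℝ)]) _
      _ = _ := by rw [← Real.exp_nat_mul]; push_cast; rw [mul_one]
  rw [h1]
  refine (mul_le_mul_of_nonneg_right h3 (Real.exp_pos _).le).trans ?_
  rw [← Real.exp_add]
  refine Real.exp_le_exp.2 ?_
  have h4 : r ≤ √T * r := le_mul_of_one_le_left hr (Real.one_le_sqrt.2 hT1)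
  have h5 := mul_le_mul_of_nonneg_left h4 hs0
  have h6 : 0 ≤ (s : ℝ) * T := by positivity
  have h7 : 0 ≤ (s : ℝ) * (√T * r) := by positivity
  -- The exponent is at most `sT - 9/8 * s * (T + √T * r)`: the first part of the penalty pays for
  -- the dimension, and the second leaves at least `s * r`.
  nlinarith

/-- The claimed probability is `N / r`. If `r ≤ N` it is trivial. Otherwise `r` exceeds `16 log (12
p)`, so half of it absorbs the entropy `2 log p`, and the remaining `exp (-r / 2)` lies below `N /
r`. -/
lemma le_excProb {n p s : ℕ} (hn : 2 ≤ n) (hp : 1 ≤ p) (hs : 1 ≤ s) (δD : ℝ) :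
    1 ≤ excProb n p δD ∨
      (p : ℝ) ^ (2 * s) * Real.exp (-(s * Real.log (max p n : ℕ) ^ (3 / 2 + δD))) ≤
        excProb n p δD := by
  have hm : 1 < ((max p n : ℕ) : ℝ) := by
    have : 1 < max p n := lt_of_lt_of_le (by omega) (le_max_right p n)
    exact_mod_cast this
  have hr : 0 < Real.log (max p n : ℕ) ^ (3 / 2 + δD) := Real.rpow_pos_of_pos (Real.log_pos hm) _
  unfold excProb
  set r := Real.log (max p n : ℕ) ^ (3 / 2 + δD)
  set N := 4 * √(Real.log (2 * p) * (1 + 64 * Real.log (12 * p) ^ 2)) with hN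
  have hp1 : (1 : ℝ) ≤ p := by exact_mod_cast hp
  set u := Real.log (12 * p) with hu
  have hu1 : 1 ≤ u := by
    rw [hu, Real.le_log_iff_exp_le (by positivity)]
    linarith [Real.exp_one_lt_d9]
  have hl : 1 / 4 ≤ Real.log (2 * p) := by
    have h1 : Real.log 2 ≤ Real.log (2 * p) := Real.log_le_log (by norm_num) (by linarith)
    linarith [Real.log_two_gt_d9]
  have hNu : 16 * u ≤ N := by
    have : 4 * u ≤ √(Real.log (2 * p) * (1 + 64 * u ^ 2)) := by
      refine Real.le_sqrt_of_sq_le ?_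
      nlinarith [mul_le_mul_of_nonneg_right hl (by positivity : 0 ≤ 1 + 64 * u ^ 2)]
    linarith
  have hlp : Real.log p ≤ u := Real.log_le_log (by linarith) (by linarith)
  by_cases hNr : r ≤ N
  · left
    rwa [one_le_div hr]
  right
  push Not at hNr
  have h1 : (p : ℝ) ^ (2 * s) * Real.exp (-(s * r)) = Real.exp (2 * Real.log p - r) ^ s := by
    rw [← Real.exp_nat_mul, pow_mul, ← Real.exp_log (by linarith : (0 : ℝ) < p),
      Real.log_exp, ← Real.exp_nat_mul, ← Real.exp_nat_mul, ← Real.exp_add]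
    congr 1
    push_cast
    ring
  rw [h1]
  have h2 : Real.exp (2 * Real.log p - r) ≤ Real.exp (-(r / 2)) :=
    Real.exp_le_exp.2 (by linarith)
  have h3 : Real.exp (2 * Real.log p - r) ≤ 1 := Real.exp_le_one_iff.2 (by linarith)
  refine (pow_le_of_le_one (Real.exp_pos _).le h3 (by omega)).trans (h2.trans ?_)
  rw [Real.exp_neg, inv_le_comm₀ (Real.exp_pos _) (by positivity), inv_div]
  have h4 := Real.add_one_le_exp (r / 2)
  refine le_trans ?_ h4
  rw [div_le_iff₀ (by linarith)]
  nlinarith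

lemma refitBounds_of_groupSupport_eq_empty {n p T : ℕ} {x : Fin n → Fin p → ℝ}
    {d : Fin n → Fin (T + 1)} {pr : Fin n → Fin (T + 1) → ℝ} {γs : Coef T p}
    {X lam pmin b κ A : ℝ} {Shat : Finset (Fin p)} {γt γh : Coef T p}
    (hs : (groupSupport γs).card = 0) :
    RefitBounds x d pr γs X lam pmin b κ A Shat γt γh := by
  intro _ _ hrate _ _ hcard _
  have h1 := (nonempty_of_sparseEigMin_pos hrate.phi_pos).card_pos
  have h2 := Finset.card_union_le Shat (groupSupport γs)
  omega

lemma noiseBound_of_eq_zero {n p T k : ℕ} {x : Fin n → Fin p → ℝ} {d : Fin n → Fin (T + 1)}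
    {pr : Fin n → Fin (T + 1) → ℝ} {ν : ℝ} (hx : ∀ i j, x i j = 0) :
    NoiseBound x d pr k ν := by
  intro S _ δ _
  simp [index, predSq, empMean, hx]

end PostMLogit

theorem mainTheorem8 {Ω E : Type*} [MeasurableSpace Ω] [MeasurableSpace E]
    (n p T : ℕ) (hT : 1 ≤ T)
    -- the law of the raw covariates and the treatment, and the propensity scores
    (P : Measure (E × Fin (T + 1))) [IsProbabilityMeasure P]
    (pr : Fin (T + 1) → E → ℝ) (hpr : PostMLogit.IsPropensityScore P pr)
    (pmin : ℝ) (hpmin : 0 < pmin) (hoverlap : ∀ᵐ z ∂P, ∀ t, pmin ≤ pr t z.1)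
    -- the transformed covariates, bounded by `X`
    (xs : E → Fin p → ℝ) (hxs : Measurable xs)
    (X : ℝ) (hX : ∀ᵐ z ∂P, ∀ j, |xs z.1 j| ≤ X)
    -- the sample
    (μ : Measure Ω) [IsProbabilityMeasure μ]
    (Z : Fin n → Ω → E × Fin (T + 1)) (hZ : ∀ i, Measurable (Z i))
    (hindep : iIndepFun Z μ) (hlaw : ∀ i, μ.map (Z i) = P)
    -- the sparse coefficients and the constant in the penalty
    (γs : PostMLogit.Coef T p) (hs : (PostMLogit.groupSupport γs).card < n)
    (δD : ℝ) (hδD : 0 < δD)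
    -- sample-dependent bounds and constants, selected set, group lasso estimate and refit
    (b κ A : Ω → ℝ) (Shat : Ω → Finset (Fin p)) (γt γh : Ω → PostMLogit.Coef T p) :
    μ {ω | ¬ PostMLogit.RefitBounds
        (fun i => xs (Z i ω).1) (fun i => (Z i ω).2) (fun i t => pr t (Z i ω).1) γs
        X (PostMLogit.penalty n p T X δD) pmin (b ω) (κ ω) (A ω) (Shat ω) (γt ω) (γh ω)} ≤
      ENNReal.ofReal (PostMLogit.excProb n p δD) := by
  open PostMLogit in
  set s := (groupSupport γs).card with hsd
  rcases Nat.eq_zero_or_pos s with hs0 | hs0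
  · have : {ω | ¬ RefitBounds
        (fun i => xs (Z i ω).1) (fun i => (Z i ω).2) (fun i t => pr t (Z i ω).1) γs
        X (penalty n p T X δD) pmin (b ω) (κ ω) (A ω) (Shat ω) (γt ω) (γh ω)} = ∅ :=
      Set.eq_empty_of_forall_notMem fun ω hω =>
        hω (refitBounds_of_groupSupport_eq_empty hs0)
    rw [this, measure_empty]
    exact zero_le
  -- From `1 ≤ s < n`; it makes `log (max p n)` positive.
  have hn : 2 ≤ n := by omega
  have hp : 1 ≤ p := by
    have : s ≤ p := (Finset.card_le_univ _).trans (by simp)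
    omega
  have hX0 : 0 ≤ X := by
    obtain ⟨z, hz⟩ := hX.exists
    exact (abs_nonneg _).trans (hz ⟨0, hp⟩)
  have hpr0 : ∀ᵐ z ∂P, ∀ t, 0 ≤ pr t z.1 := hoverlap.mono fun z hz t => hpmin.le.trans (hz t)
  have hsample : ∀ᵐ ω ∂μ, ∀ i, (∀ t, pmin ≤ pr t (Z i ω).1) ∧ (∀ j, |xs (Z i ω).1 j| ≤ X) ∧
      ∑ t, pr t (Z i ω).1 = 1 := ae_all_iff.2 fun i => by
    refine ae_of_ae_map (hZ i).aemeasurable (p := fun z => (∀ t, pmin ≤ pr t z.1) ∧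
      (∀ j, |xs z.1 j| ≤ X) ∧ ∑ t, pr t z.1 = 1) ?_
    rw [hlaw i]
    exact hoverlap.and (hX.and hpr.sum_eq_one)
  set ν := 3 / 4 * penalty n p T X δD * √s / X with hν
  have hdet : ∀ ω, (∀ i, (∀ t, pmin ≤ pr t (Z i ω).1) ∧ (∀ j, |xs (Z i ω).1 j| ≤ X) ∧
      ∑ t, pr t (Z i ω).1 = 1) →
      NoiseBound (fun i => xs (Z i ω).1) (fun i => (Z i ω).2) (fun i t => pr t (Z i ω).1)
        (2 * s) ν →
      RefitBounds (fun i => xs (Z i ω).1) (fun i => (Z i ω).2) (fun i t => pr t (Z i ω).1) γs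
        X (penalty n p T X δD) pmin (b ω) (κ ω) (A ω) (Shat ω) (γt ω) (γh ω) := fun ω hω hN =>
    refitBounds_of_noiseBound hT hX0 (fun i => (hω i).2.1)
      (fun h => penalty_pos (by omega) hT h δD) (fun i => (hω i).1) (fun i => (hω i).2.2)
      (by omega) hN
  -- When `X = 0` the covariates vanish almost surely and there is no noise to bound, whatever value
  -- the division by `X` takes.
  rcases hX0.eq_or_lt with hX00 | hXp
  · refine le_of_eq_of_le (measure_eq_zero_iff_ae_notMem.2 ?_) zero_le
    filter_upwards [hsample] with ω hω
    refine not_not.2 (hdet ω hω (noiseBound_of_eq_zero fun i j => ?_))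
    exact abs_nonpos_iff.1 (((hω i).2.1 j).trans hX00.symm.le)
  have hν0 : 0 ≤ ν := by
    have := penalty_pos (p := p) (by omega : 0 < n) hT hXp δD
    positivity
  rcases le_excProb hn hp hs0 δD with h1 | h1
  · exact prob_le_one.trans (by simpa using h1)
  set bad : (Fin (2 * s) → Fin p) → Set (Fin n → E × Fin (T + 1)) := fun f =>
    {z | ∃ δ : Coef T (2 * s), ν * √(predSq (fun i l => xs (z i).1 (f l)) δ) <
      |noiseInner (fun i l => xs (z i).1 (f l)) (fun i => (z i).2)
        (fun i t => pr t (z i).1) δ|} with hbad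
  have hxf : ∀ f : Fin (2 * s) → Fin p, Measurable fun (e : E) l => xs e (f l) := fun f =>
    measurable_pi_lambda _ fun l => (measurable_pi_apply (f l)).comp hxs
  have hbm : ∀ f, MeasurableSet (bad f) := fun f =>
    measurableSet_not_noise (hxf f) (fun t => (hpr t).1) ν
  have hpi : μ.map (fun ω i => Z i ω) = Measure.pi fun _ : Fin n => P := by
    rw [(iIndepFun_iff_map_fun_eq_pi_map fun i => (hZ i).aemeasurable).1 hindep]
    simp_rw [hlaw]
  have hbp : ∀ f, μ ((fun ω i => Z i ω) ⁻¹' bad f) ≤ ENNReal.ofReal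
      (Real.exp (-(s * Real.log (max p n : ℕ) ^ (3 / 2 + δD)))) := fun f => by
    rw [← Measure.map_apply (measurable_pi_lambda _ hZ) (hbm f), hpi]
    exact (measure_not_noise_le (by omega) (hxf f) hpr hpr0 hν0).trans
      (ENNReal.ofReal_le_ofReal (noise_tail_le (by omega) hT hXp δD))
  calc μ _ ≤ μ (⋃ f, (fun ω i => Z i ω) ⁻¹' bad f) := by
        -- The failure event need not be measurable, as the sample-dependent choices are arbitrary;
        -- it is only covered, up to a null set, by the measurable noise events.
        refine measure_mono_ae ?_
        filter_upwards [hsample] with ω hω hR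
        by_contra hcon
        refine hR (hdet ω hω (noiseBound_of_forall fun f δ => ?_))
        by_contra! hlt
        exact hcon (Set.mem_iUnion.2 ⟨f, δ, hlt⟩)
    _ ≤ ∑ f, μ ((fun ω i => Z i ω) ⁻¹' bad f) := measure_iUnion_fintype_le _ _
    _ ≤ ∑ _f : Fin (2 * s) → Fin p, ENNReal.ofReal
        (Real.exp (-(s * Real.log (max p n : ℕ) ^ (3 / 2 + δD)))) :=
        Finset.sum_le_sum fun f _ => hbp f
    _ = ENNReal.ofReal ((p : ℝ) ^ (2 * s) *
        Real.exp (-(s * Real.log (max p n : ℕ) ^ (3 / 2 + δD)))) := by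
        rw [Finset.sum_const, Finset.card_univ, Fintype.card_fun, Fintype.card_fin,
          Fintype.card_fin, nsmul_eq_mul, ENNReal.ofReal_mul (by positivity),
          ENNReal.ofReal_pow (Nat.cast_nonneg p), ENNReal.ofReal_natCast]
        push_cast
        rfl
    _ ≤ ENNReal.ofReal (excProb n p δD) := ENNReal.ofReal_le_ofReal h1
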